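/- Let $V=\bigcup_n V_n$ be the superstructure over the set $\mathbb N$ of urelements ($V_0=\mathbb N$, $V_{n+1}=V_n\cup\mathcal P(V_n)$), and let ${}^*V$ be a nonstandard universe, that is, the truncation at ${}^*\!\in$-rank $\omega$ of an elementary extension of $(V,\in)$ with ${}^*\mathbb N\setminus\mathbb N\neq\emptyset$. Assume that ${}^*V$ is $\omega_1$-saturated: every countable family of internal sets with the finite intersection property has nonempty intersection. For $H\in{}^*\mathbb N\setminus\mathbb N$ let $\Omega=\{1,2,\dots,H\}$, let $P(A)={}^*|A|/H$ for each internal $A\subseteq\Omega$, and let $(\Omega,\Sigma,L_P)$ be the hyperfinite Loeb space generated by $P$: $\Sigma$ is the complete $\sigma$-algebra generated by the internal subsets of $\Omega$ and $L_P$ is the complete countably additive extension of $\mathrm{st}\circ P$ to $\Sigma$. A probability space $(\Omega,\Sigma,L_P)$ is called compact if there is a family $\mathcal C\subseteq\Sigma$ such that $\bigcap\mathcal D\neq\emptyset$ for every $\mathcal D\subseteq\mathcal C$ with the finite intersection property, and such that $L_P(A)=\sup\{L_P(C): C\in\mathcal C,\ C\subseteq A\}$ for every $A\in\Sigma$. Assume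 the Continuum Hypothesis and $|{}^*\mathbb N|=\omega_1$. Then every hyperfinite Loeb space in ${}^*V$ is compact. -/

import Mathlib

open FirstOrder Cardinal MeasureTheory

universe u

namespace NSA

/-! ### The language of set theory -/

/-- The only non-logical symbol is a binary relation symbol, for membership. -/
inductive MemRel : ℕ → Type
  | mem : MemRel 2

/-- The first-order language of set theory. -/
def setLang : Language := ⟨fun _ => Empty, MemRel⟩

/-- The membership relation of a structure for the language of set theory. -/
def E {M : Type*} [setLang.Structure M] (x y : M) : Prop :=
  Language.Structure.RelMap (L := setLang) (M := M) MemRel.mem ![x, y]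

theorem comp_pair {M N : Type*} (f : M → N) (x y : M) : f ∘ ![x, y] = ![f x, f y] := by
  funext i
  fin_cases i <;> rfl

/-! ### The standard universe: the superstructure over the set `ℕ` of urelements

`V₀ = ℕ`, `Vₙ₊₁ = Vₙ ∪ 𝒫(Vₙ)`, `V = ⋃ₙ Vₙ`. Since every element of `Vₙ` is an urelement or a subset
of `Vₙ`, one has `Vₙ₊₁ = ℕ ∪ 𝒫(Vₙ)`, a disjoint union. -/

/-- The level `Vₙ`, as a type. -/
def Level : ℕ → Type
  | 0 => ℕ
  | n + 1 => ℕ ⊕ Set (Level n)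

namespace Level

/-- The inclusion of `Vₙ` in `Vₙ₊₁`. -/
def up : (n : ℕ) → Level n → Level (n + 1)
  | 0 => fun k => Sum.inl k
  | n + 1 => Sum.map id (fun s : Set (Level n) => up n '' s)

theorem up_injective : ∀ n, Function.Injective (up n)
  | 0 => Sum.inl_injective
  | n + 1 => Sum.map_injective.2
      ⟨Function.injective_id, (up_injective n).image_injective⟩

/-- A natural number, as an urelement in `Vₙ`. -/
def atom : (n : ℕ) → ℕ → Level n
  | 0 => fun k => k
  | _ + 1 => fun k => Sum.inl k

/-- A set of elements of `Vₙ`, as an element of `Vₙ₊₁`. -/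
def ofSet {n : ℕ} (s : Set (Level n)) : Level (n + 1) := Sum.inr s

/-- Membership between elements of `Vₙ`: urelements have no elements. -/
def Mem : (n : ℕ) → Level n → Level n → Prop
  | 0 => fun _ _ => False
  | n + 1 => fun x y => Sum.elim (fun _ => False) (fun s : Set (Level n) => x ∈ up n '' s) y

theorem mem_up : ∀ (n : ℕ) (x y : Level n), Mem (n + 1) (up n x) (up n y) ↔ Mem n x y
  | 0, _, _ => Iff.rfl
  | _ + 1, _, Sum.inl _ => Iff.rfl
  | n + 1, _, Sum.inr _ => (up_injective (n + 1)).mem_set_image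

instance (n : ℕ) : setLang.Structure (Level n) where
  funMap f := Empty.elim f
  RelMap {_} r := match r with
    | MemRel.mem => fun v => Mem n (v 0) (v 1)

/-- The inclusion of `Vₙ` in `Vₙ₊₁` as an embedding of structures. -/
def upEmb (n : ℕ) : Level n ↪[setLang] Level (n + 1) where
  toFun := up n
  inj' := up_injective n
  map_fun' f := Empty.elim f
  map_rel' {_} r v := by
    cases r
    exact mem_up n (v 0) (v 1)

/-- The Kuratowski pair `{{a}, {a, b}}`. -/
def pair {n : ℕ} (a b : Level n) : Level (n + 2) :=
  ofSet {ofSet {a}, ofSet {a, b}}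

end Level

/-- The standard universe `V = ⋃ₙ Vₙ` with its membership relation. -/
abbrev V : Type :=
  Language.DirectLimit Level (Language.DirectedSystem.natLERec Level.upEmb)

/-- The inclusion of `Vₙ` in `V`. -/
noncomputable def Level.toV {n : ℕ} (x : Level n) : V :=
  Language.DirectLimit.of setLang ℕ Level (Language.DirectedSystem.natLERec Level.upEmb) n x

/-- The set `Vₙ`, as an element of `V`. -/
noncomputable def levelSet (n : ℕ) : V := (Level.ofSet (Set.univ : Set (Level n))).toV

/-- Every element of `V` belongs to some `Vₙ`. -/
theorem exists_E_levelSet (x : V) : ∃ n, E x (levelSet n) := by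
  obtain ⟨n, y, rfl⟩ := Language.DirectLimit.exists_of x
  refine ⟨n, ?_⟩
  have h1 : (Language.DirectLimit.of setLang ℕ Level
      (Language.DirectedSystem.natLERec Level.upEmb) n) y = (Level.up n y).toV := by
    rw [Level.toV, ← Language.DirectLimit.of_f (hij := Nat.le_succ n)]
    congr 1
    rw [Language.DirectedSystem.coe_natLERec]
    refine (Nat.leRecOn_succ (C := Level) le_rfl y).trans ?_
    rw [Nat.leRecOn_self]
    rfl
  rw [h1]
  have h2 : E (Level.up n y) (Level.ofSet (Set.univ : Set (Level n))) := ⟨y, trivial, rfl⟩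
  rw [E, levelSet, Level.toV, Level.toV, ← comp_pair]
  exact (Language.Embedding.map_rel _ _ _).2 h2

/-! ### Standard objects in `V` -/

/-- The natural number `k` as an urelement of `V`. -/
noncomputable def natV (k : ℕ) : V := (Level.atom 0 k).toV

/-- The power set `𝒫(ℕ)`. -/
noncomputable def powNatV : V :=
  (Level.ofSet (Set.range fun s : Set ℕ => (Level.ofSet s : Level 1))).toV

/-- The order of `ℕ`, as a set of ordered pairs. -/
noncomputable def leV : V :=
  (Level.ofSet {p : Level 2 | ∃ a b : ℕ, a ≤ b ∧ p = Level.pair (n := 0) a b}).toV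

/-- The cardinality function from the set of finite subsets of `ℕ` to `ℕ`,
as a set of ordered pairs. -/
noncomputable def cardV : V :=
  (Level.ofSet {p : Level 3 | ∃ s : Finset ℕ,
    p = Level.pair (n := 1) (Level.ofSet (n := 0) (s : Set ℕ)) (Level.atom 1 s.card)}).toV

/-- A real number in `V`: its lower Dedekind cut, a set of rational numbers, where the rational
numbers are numbered by natural numbers. -/
def realCode (r : ℝ) : Level 1 :=
  Level.ofSet {k : ℕ | ∃ q : ℚ, Encodable.encode q = k ∧ (q : ℝ) < r}

/-- A real number as an element of `V`. -/
noncomputable def realV (r : ℝ) : V := (realCode r).toV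

/-- The order of `[0, 1]`, as a set of ordered pairs. -/
noncomputable def leUnitV : V :=
  (Level.ofSet {p : Level 3 | ∃ r ∈ Set.Icc (0 : ℝ) 1, ∃ s ∈ Set.Icc (0 : ℝ) 1, r ≤ s ∧
    p = Level.pair (realCode r) (realCode s)}).toV

/-- The function `(k, h) ↦ k / h` from `{(k, h) : k ≤ h, 1 ≤ h}` to `[0, 1]`,
as a set of ordered pairs. -/
noncomputable def divV : V :=
  (Level.ofSet {p : Level 4 | ∃ k h : ℕ, k ≤ h ∧ 1 ≤ h ∧
    p = Level.pair (Level.pair (n := 0) k h) (Level.up 1 (realCode ((k : ℝ) / h)))}).toV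

/-! ### Nonstandard universes -/

/-- A nonstandard universe is given by an elementary extension of the standard universe in which
there are nonstandard natural numbers; its underlying set is the truncation `Carrier` below. -/
structure NonstandardUniverse where
  /-- The elementary extension of the standard universe, before truncation. -/
  Ext : Type u
  /-- Its membership relation. -/
  [str : setLang.Structure Ext]
  /-- The elementary embedding of the standard universe. -/
  emb : V ↪ₑ[setLang] Ext
  /-- `*ℕ ∖ ℕ` is not empty. -/
  exists_nonstandard : ∃ x : Ext, E x (emb (levelSet 0)) ∧ ∀ k : ℕ, x ≠ emb (natV k)

attribute [instance] NonstandardUniverse.str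

namespace NonstandardUniverse

variable (U : NonstandardUniverse.{u})

/-- The set `*V`: the elements of the extension that have finite rank in its sense, that is, those
that belong to `*Vₙ` for a standard `n`. Its elements are the internal objects. -/
def Carrier : Type u := {x : U.Ext // ∃ n : ℕ, E x (U.emb (levelSet n))}

instance : Membership U.Carrier U.Carrier where
  mem y x := E x.1 y.1

/-- The map `x ↦ *x` from `V` to `*V`. -/
noncomputable def star (x : V) : U.Carrier :=
  ⟨U.emb x, (exists_E_levelSet x).imp fun n hn => by
    rw [E, ← comp_pair]
    exact (U.emb.map_rel _ _).2 hn⟩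

instance : Nonempty U.Carrier := ⟨U.star (natV 0)⟩

/-- `*V` is `κ`-saturated: every family of fewer than `κ` internal sets with the finite
intersection property has a common element. -/
def IsSaturated (κ : Cardinal.{u}) : Prop :=
  ∀ F : Set U.Carrier, #F < κ →
    (∀ F₀ : Set U.Carrier, F₀ ⊆ F → F₀.Finite → ∃ x : U.Carrier, ∀ a ∈ F₀, x ∈ a) →
    ∃ x : U.Carrier, ∀ a ∈ F, x ∈ a

/-- The set `*ℕ` of hypernatural numbers. -/
def Hypernat : Type u := {x : U.Carrier // x ∈ U.star (levelSet 0)}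

/-- A hypernatural number is hyperfinite if it is in `*ℕ ∖ ℕ`. -/
def IsHyperfinite (H : U.Hypernat) : Prop := ∀ k : ℕ, H.1 ≠ U.star (natV k)

variable {U}

/-- In `*V`, `p` is the ordered pair `(a, b) = {{a}, {a, b}}`. -/
def IsPair (p a b : U.Carrier) : Prop :=
  ∃ s t : U.Carrier, (∀ w, w ∈ s ↔ w = a) ∧ (∀ w, w ∈ t ↔ w = a ∨ w = b) ∧
    ∀ w, w ∈ p ↔ w = s ∨ w = t

/-- The ordered pair `(a, b)` in `*V`. -/
noncomputable def pr (a b : U.Carrier) : U.Carrier := Classical.epsilon fun p => IsPair p a b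

/-- The value at `x` of an internal function `f`, a set of ordered pairs in `*V`. -/
noncomputable def app (f x : U.Carrier) : U.Carrier := Classical.epsilon fun y => pr x y ∈ f

/-- The internal cardinality `*|a|` of a hyperfinite internal subset `a` of `*ℕ`. -/
noncomputable def icard (a : U.Carrier) : U.Carrier := app (U.star cardV) a

/-- The quotient `k / h` in `*[0, 1]` of hypernatural numbers `k ≤ h` with `1 ≤ h`. -/
noncomputable def idiv (k h : U.Carrier) : U.Carrier := app (U.star divV) (pr k h)

/-- The standard part map from `*[0, 1]` to `[0, 1]`. -/
noncomputable def st (x : U.Carrier) : ℝ :=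
  sSup {r : ℝ | r ∈ Set.Icc (0 : ℝ) 1 ∧ pr (U.star (realV r)) x ∈ U.star leUnitV}

/-! ### Hyperfinite Loeb spaces -/

/-- The internal set `{1, 2, …, H}`. -/
def Omega (H : U.Hypernat) : Type u :=
  {x : U.Hypernat // pr (U.star (natV 1)) x.1 ∈ U.star leV ∧ pr x.1 H.1 ∈ U.star leV}

variable (H : U.Hypernat)

/-- The set of elements in `{1, …, H}` of an element of `*V`. -/
def extent (a : U.Carrier) : Set (Omega H) := {x | x.1.1 ∈ a}

/-- `a` is an internal subset of `{1, …, H}`. -/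
def IsInternalSubset (a : U.Carrier) : Prop :=
  a ∈ U.star powNatV ∧ ∀ x : U.Carrier, x ∈ a → ∃ y : Omega H, y.1.1 = x

/-- The internal uniform probability `P(a) = *|a| / H` in `*[0, 1]`. -/
noncomputable def internalProb (a : U.Carrier) : U.Carrier := idiv (icard a) H.1

open Classical in
/-- The outer measure on `{1, …, H}` that is generated by the finitely additive probability
`st ∘ P` on the algebra of internal subsets: the infimum of the sums of `st (P aₙ)` over all
countable covers by internal subsets `aₙ`. The set function below has the value `∞` at the subsets
that are not internal. -/
noncomputable def loebOuter : OuterMeasure (Omega H) :=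
  OuterMeasure.boundedBy fun A : Set (Omega H) =>
    ⨅ (a : U.Carrier) (_ : IsInternalSubset H a ∧ extent H a = A),
      ENNReal.ofReal (st (internalProb H a))

/-- The Loeb `σ`-algebra on `{1, …, H}`: the Carathéodory measurable sets. By Carathéodory's
extension theorem, this is the completion of the `σ`-algebra generated by the internal subsets. -/
noncomputable instance loebSpace : MeasurableSpace (Omega H) := (loebOuter H).caratheodory

/-- The Loeb measure on `{1, …, H}`: the complete countably additive extension of `st ∘ P`. -/
noncomputable def loebMeasure : Measure (Omega H) := (loebOuter H).toMeasure le_rfl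

end NonstandardUniverse

/-! ### Compact measure spaces -/

/-- A family of sets is compact if each of its subfamilies with the finite intersection property
has a common element. -/
def IsCompactFamily {X : Type*} (𝒞 : Set (Set X)) : Prop :=
  ∀ 𝒟 : Set (Set X), 𝒟 ⊆ 𝒞 →
    (∀ F : Set (Set X), F ⊆ 𝒟 → F.Finite → (⋂₀ F).Nonempty) → (⋂₀ 𝒟).Nonempty

/-- A measure space is compact if there is a compact family of measurable sets that is
inner-regular: the measure of each measurable set is the supremum of the measures of its subsets
in the family. -/
def IsCompactMeasureSpace {X : Type*} [MeasurableSpace X] (μ : Measure X) : Prop :=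
  ∃ 𝒞 : Set (Set X), (∀ C ∈ 𝒞, MeasurableSet C) ∧ IsCompactFamily 𝒞 ∧
    ∀ A : Set X, MeasurableSet A → IsLUB (μ '' {C | C ∈ 𝒞 ∧ C ⊆ A}) (μ A)

end NSA

/-! A countable intersection of internal sets behaves well in countable families by
$\omega_1$-saturation, and such sets are inner-regular for the Loeb measure (`exists_inner`). The
difficulty is an uncountable subfamily with the finite intersection property. The remedy is to
shrink each of these sets slightly, so that no uncountable subfamily of the shrunken sets has that
property.

The shrinking uses a map $f$ from $\Omega$ to the Cantor space, the standard binary digits of a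
hypernatural number. Fixing the first $n$ digits fixes a residue modulo $2^n$, and since $H$ is
infinite this has probability at most $2/2^n$ (`loebMeasure_cyl_le`); so each point $p$ of the
Cantor space has cylinders whose preimages have arbitrarily small measure.

Hyperfinite sets are coded by hypernatural numbers, so there are at most $\aleph_1$ internal subsets
of $\Omega$. By CH there are then at most $\aleph_1$ pairs $i=(c,n)$ of a sequence $c$ of internal
sets and a number $n$, and $\aleph_1$ points $p$. Index both injectively by $\omega_1$. Let $C_i$ be
$\bigcap_k c_k$ without the preimages of cylinders around the countably many points $p$ that come
before $i$, of total measure at most $1/n$. If a subfamily has the finite intersection property,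
then compactness of the Cantor space gives a point $s$ outside all the cylinders that the members
remove. So $s$ comes before no member, the subfamily is countable, and saturation applies. This is
`isCompactMeasureSpace_of_cantor`; the rest verifies its hypotheses by transfer. -/

namespace NSA

/-! ### Membership in the superstructure -/

namespace Level

theorem toV_injective {n : ℕ} : Function.Injective (toV (n := n)) :=
  (Language.DirectLimit.of setLang ℕ Level
    (Language.DirectedSystem.natLERec Level.upEmb) n).injective

theorem toV_up {n : ℕ} (x : Level n) : (up n x).toV = x.toV := by
  symm
  rw [toV, toV, ← Language.DirectLimit.of_f (hij := Nat.le_succ n)]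
  congr 1
  rw [Language.DirectedSystem.coe_natLERec]
  refine (Nat.leRecOn_succ (C := Level) le_rfl x).trans ?_
  rw [Nat.leRecOn_self]
  rfl

theorem E_toV {n : ℕ} (x y : Level n) : E x.toV y.toV ↔ Mem n x y := by
  rw [E, toV, toV, ← comp_pair]
  exact Language.Embedding.map_rel _ _ _

theorem exists_toV (z : V) : ∃ n, ∃ x : Level n, z = x.toV := by
  obtain ⟨n, y, rfl⟩ := Language.DirectLimit.exists_of z
  exact ⟨n, y, rfl⟩

theorem exists_toV_of_le {m n : ℕ} (h : m ≤ n) (x : Level m) : ∃ y : Level n, x.toV = y.toV := by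
  induction h with
  | refl => exact ⟨x, rfl⟩
  | step _ ih =>
    obtain ⟨y, hy⟩ := ih
    exact ⟨up _ y, by rw [toV_up, hy]⟩

theorem toV_ofSet_image_up {n : ℕ} (s : Set (Level n)) :
    (ofSet (up n '' s)).toV = (ofSet s).toV :=
  toV_up (ofSet s)

/-- Membership is defined inside a single level, so `z` and the set have to be brought to a common
one. When `z` lies too high, the set is raised by `up`, which does not change it as an element of
`V`; the induction is on the number of levels still missing. -/
theorem E_toV_ofSet {n : ℕ} (s : Set (Level n)) (z : V) :
    E z (ofSet s).toV ↔ ∃ x ∈ s, z = x.toV := by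
  obtain ⟨m, y, rfl⟩ := exists_toV z
  obtain ⟨d, hd⟩ : ∃ d, m ≤ n + 1 + d := ⟨m, by omega⟩
  induction d generalizing n with
  | zero =>
    obtain ⟨y', hy'⟩ := exists_toV_of_le hd y
    rw [hy', E_toV]
    constructor
    · rintro ⟨x, hx, rfl⟩
      exact ⟨x, hx, toV_up x⟩
    · rintro ⟨x, hx, h⟩
      exact ⟨x, hx, toV_injective ((toV_up x).trans h.symm)⟩
  | succ d ih =>
    rw [← toV_ofSet_image_up, ih _ (by omega)]
    constructor
    · rintro ⟨_, ⟨x, hx, rfl⟩, h⟩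
      exact ⟨x, hx, h.trans (toV_up x)⟩
    · rintro ⟨x, hx, h⟩
      exact ⟨_, ⟨x, hx, rfl⟩, h.trans (toV_up x).symm⟩

theorem toV_atom (n k : ℕ) : (atom n k).toV = natV k := by
  induction n with
  | zero => rfl
  | succ n ih =>
    rw [← ih, ← toV_up (atom n k)]
    cases n <;> rfl

theorem not_E_natV (z : V) (k : ℕ) : ¬ E z (natV k) := by
  obtain ⟨m, y, rfl⟩ := exists_toV z
  rw [← toV_atom m, E_toV]
  cases m <;> exact id

theorem not_E_inl {n : ℕ} (z : V) (k : ℕ) : ¬ E z (toV (n := n + 1) (Sum.inl k)) := by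
  have h := not_E_natV z k
  rwa [← toV_atom (n + 1) k] at h

theorem natV_injective : Function.Injective natV := toV_injective (n := 0)

end Level

/-! ### Ordered pairs and the coded standard objects -/

/-- In a structure for the language of set theory, `p` is the pair `{{a}, {a, b}}`. -/
def IsPr {M : Type*} [setLang.Structure M] (p a b : M) : Prop :=
  ∃ s t : M, (∀ w : M, E w s ↔ w = a) ∧ (∀ w : M, E w t ↔ w = a ∨ w = b) ∧
    ∀ w : M, E w p ↔ w = s ∨ w = t

/-- Elements with a common element are equal if they have the same elements. -/
theorem ext_V {x y z : V} (hz : E z x) (h : ∀ w : V, E w x ↔ E w y) : x = y := by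
  obtain ⟨m, x, rfl⟩ := Level.exists_toV x
  obtain ⟨n, y, rfl⟩ := Level.exists_toV y
  -- The common level is a successor, where each element is an urelement or a set. The common
  -- element excludes urelements, which are distinct although all are empty.
  obtain ⟨x', hx⟩ := Level.exists_toV_of_le (m := m) (n := m + n + 1) (by omega) x
  obtain ⟨y', hy⟩ := Level.exists_toV_of_le (m := n) (n := m + n + 1) (by omega) y
  simp only [hx, hy] at hz h ⊢
  clear hx hy x y
  rcases x' with k | s
  · exact absurd hz (Level.not_E_inl _ _)
  rcases y' with k | t
  · exact absurd ((h z).1 hz) (Level.not_E_inl _ _)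
  change (Level.ofSet s).toV = (Level.ofSet t).toV
  congr 2
  ext w
  have := h w.toV
  change E _ (Level.ofSet s).toV ↔ E _ (Level.ofSet t).toV at this
  simp only [Level.E_toV_ofSet] at this
  constructor
  · intro hw
    obtain ⟨w', h', e⟩ := this.1 ⟨w, hw, rfl⟩
    rwa [Level.toV_injective e]
  · intro hw
    obtain ⟨w', h', e⟩ := this.2 ⟨w, hw, rfl⟩
    rwa [Level.toV_injective e]

theorem IsPr.unique {p q a b : V} (hp : IsPr p a b) (hq : IsPr q a b) : p = q := by
  obtain ⟨s, t, hs, ht, hp⟩ := hp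
  obtain ⟨s', t', hs', ht', hq⟩ := hq
  obtain rfl : s = s' := ext_V ((hs a).2 rfl) fun w => by rw [hs, hs']
  obtain rfl : t = t' := ext_V ((ht a).2 (Or.inl rfl)) fun w => by rw [ht, ht']
  exact ext_V ((hp s).2 (Or.inl rfl)) fun w => by rw [hp, hq]

theorem IsPr.inj {p a b a' b' : V} (hp : IsPr p a b) (hq : IsPr p a' b') : a = a' ∧ b = b' := by
  obtain ⟨s, t, hs, ht, hp⟩ := hp
  obtain ⟨s', t', hs', ht', hq⟩ := hq
  have e1 : a = a' := by
    rcases (hq s).1 ((hp s).2 (Or.inl rfl)) with rfl | rfl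
    · exact (hs' a).1 ((hs a).2 rfl)
    · exact ((hs a').1 ((ht' a').2 (Or.inl rfl))).symm
  subst e1
  refine ⟨rfl, ?_⟩
  have h1 : b = a ∨ b = b' := by
    rcases (hq t).1 ((hp t).2 (Or.inr rfl)) with rfl | rfl
    · exact Or.inl ((hs' b).1 ((ht b).2 (Or.inr rfl)))
    · exact (ht' b).1 ((ht b).2 (Or.inr rfl))
  have h2 : b' = a ∨ b' = b := by
    rcases (hp t').1 ((hq t').2 (Or.inr rfl)) with rfl | rfl
    · exact Or.inl ((hs b').1 ((ht' b').2 (Or.inr rfl)))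
    · exact (ht b').1 ((ht' b').2 (Or.inr rfl))
  rcases h1 with rfl | h1
  · rcases h2 with h | h <;> exact h.symm
  · exact h1

theorem isPr_toV_pair {n : ℕ} (a b : Level n) : IsPr (Level.pair a b).toV a.toV b.toV := by
  refine ⟨(Level.ofSet {a}).toV, (Level.ofSet {a, b}).toV, fun w => ?_, fun w => ?_, fun w => ?_⟩
  · simp [Level.E_toV_ofSet]
  · simp [Level.E_toV_ofSet]
  · simp [Level.pair, Level.E_toV_ofSet]

/-- `f` contains the pair `(a, b)`. -/
def Rel {M : Type*} [setLang.Structure M] (f a b : M) : Prop := ∃ p, IsPr p a b ∧ E p f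

/-- A set of pairs of elements of a level, as an element of `V`, contains `(a, b)` iff the set
does. -/
theorem rel_toV_ofSet {n : ℕ} (s : Set (Level (n + 2))) (r : Level n → Level n → Prop)
    (hs : ∀ p, p ∈ s ↔ ∃ a b, r a b ∧ p = Level.pair a b) (x y : V) :
    Rel (Level.ofSet s).toV x y ↔ ∃ a b, r a b ∧ x = a.toV ∧ y = b.toV := by
  simp only [Rel, Level.E_toV_ofSet]
  constructor
  · rintro ⟨p, hp, q, hq, rfl⟩
    obtain ⟨a, b, hr, rfl⟩ := (hs q).1 hq
    obtain ⟨rfl, rfl⟩ := hp.inj (isPr_toV_pair a b)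
    exact ⟨a, b, hr, rfl, rfl⟩
  · rintro ⟨a, b, hr, rfl, rfl⟩
    exact ⟨_, isPr_toV_pair a b, _, (hs _).2 ⟨a, b, hr, rfl⟩, rfl⟩

/-- A set of natural numbers, as an element of `V`. -/
noncomputable def setV (s : Set ℕ) : V := (Level.ofSet (n := 0) s).toV

theorem setV_univ : setV Set.univ = levelSet 0 := rfl

theorem E_setV {s : Set ℕ} {z : V} : E z (setV s) ↔ ∃ k ∈ s, z = natV k :=
  Level.E_toV_ofSet (n := 0) s z

theorem natV_E_setV {s : Set ℕ} {k : ℕ} : E (natV k) (setV s) ↔ k ∈ s := by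
  rw [E_setV]
  constructor
  · rintro ⟨j, hj, e⟩
    rwa [Level.natV_injective e]
  · exact fun h => ⟨k, h, rfl⟩

theorem E_levelSet_zero {z : V} : E z (levelSet 0) ↔ ∃ k, z = natV k := by
  rw [← setV_univ, E_setV]
  simp

theorem E_powNatV {z : V} : E z powNatV ↔ ∃ s, z = setV s := by
  rw [powNatV, Level.E_toV_ofSet]
  simp [setV]

theorem E_levelSet {n : ℕ} {z : V} : E z (levelSet n) ↔ ∃ x : Level n, z = x.toV := by
  rw [levelSet, Level.E_toV_ofSet]
  simp

/-- A relation on `ℕ`, as an element of `V`. -/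
noncomputable def relV (r : ℕ → ℕ → Prop) : V :=
  (Level.ofSet {p : Level 2 | ∃ a b : ℕ, r a b ∧ p = Level.pair (n := 0) a b}).toV

theorem leV_eq_relV : leV = relV (· ≤ ·) := rfl

theorem rel_relV {r : ℕ → ℕ → Prop} {x y : V} :
    Rel (relV r) x y ↔ ∃ a b, r a b ∧ x = natV a ∧ y = natV b :=
  rel_toV_ofSet (n := 0) _ r (fun _ => Iff.rfl) x y

theorem rel_relV_natV {r : ℕ → ℕ → Prop} {a b : ℕ} : Rel (relV r) (natV a) (natV b) ↔ r a b := by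
  rw [rel_relV]
  constructor
  · rintro ⟨c, d, h, e1, e2⟩
    rwa [Level.natV_injective e1, Level.natV_injective e2]
  · exact fun h => ⟨a, b, h, rfl, rfl⟩

theorem rel_cardV {x y : V} :
    Rel cardV x y ↔ ∃ s : Finset ℕ, x = setV (s : Set ℕ) ∧ y = natV s.card := by
  rw [cardV, rel_toV_ofSet (n := 1) _
    (fun a b => ∃ s : Finset ℕ, a = Level.ofSet (n := 0) (s : Set ℕ) ∧ b = Level.atom 1 s.card)]
  · constructor
    · rintro ⟨_, _, ⟨s, rfl, rfl⟩, rfl, rfl⟩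
      exact ⟨s, rfl, Level.toV_atom _ _⟩
    · rintro ⟨s, rfl, rfl⟩
      exact ⟨_, _, ⟨s, rfl, rfl⟩, rfl, (Level.toV_atom _ _).symm⟩
  · intro p
    constructor
    · rintro ⟨s, rfl⟩
      exact ⟨_, _, ⟨s, rfl, rfl⟩, rfl⟩
    · rintro ⟨_, _, ⟨s, rfl, rfl⟩, rfl⟩
      exact ⟨s, rfl⟩

theorem setV_injective : Function.Injective setV := fun s t h => by
  have := Level.toV_injective (n := 1) h
  exact Sum.inr_injective this

theorem realV_injective : Function.Injective realV := by
  intro r s h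
  have h1 : realCode r = realCode s := Level.toV_injective h
  have h2 := Sum.inr_injective h1
  have key : ∀ q : ℚ, (q : ℝ) < r ↔ (q : ℝ) < s := by
    intro q
    have : (∃ q' : ℚ, Encodable.encode q' = Encodable.encode q ∧ (q' : ℝ) < r) ↔
        ∃ q' : ℚ, Encodable.encode q' = Encodable.encode q ∧ (q' : ℝ) < s :=
      Set.ext_iff.1 h2 (Encodable.encode q)
    simpa using this
  apply le_antisymm
  · by_contra! hlt
    obtain ⟨q, h1, h2⟩ := exists_rat_btwn hlt
    exact absurd ((key q).1 h2) (not_lt.2 h1.le)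
  · by_contra! hlt
    obtain ⟨q, h1, h2⟩ := exists_rat_btwn hlt
    exact absurd ((key q).2 h2) (not_lt.2 h1.le)

theorem rel_leUnitV {x y : V} :
    Rel leUnitV x y ↔ ∃ r s : ℝ, 0 ≤ r ∧ r ≤ s ∧ s ≤ 1 ∧ x = realV r ∧ y = realV s := by
  rw [leUnitV, rel_toV_ofSet (n := 1) _ (fun a b => ∃ r ∈ Set.Icc (0 : ℝ) 1,
    ∃ s ∈ Set.Icc (0 : ℝ) 1, r ≤ s ∧ a = realCode r ∧ b = realCode s)]
  · constructor
    · rintro ⟨_, _, ⟨r, hr, s, hs, h, rfl, rfl⟩, rfl, rfl⟩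
      exact ⟨r, s, hr.1, h, hs.2, rfl, rfl⟩
    · rintro ⟨r, s, hr, h, hs, rfl, rfl⟩
      exact ⟨_, _, ⟨r, ⟨hr, h.trans hs⟩, s, ⟨hr.trans h, hs⟩, h, rfl, rfl⟩, rfl, rfl⟩
  · intro p
    constructor
    · rintro ⟨r, hr, s, hs, h, rfl⟩
      exact ⟨_, _, ⟨r, hr, s, hs, h, rfl, rfl⟩, rfl⟩
    · rintro ⟨_, _, ⟨r, hr, s, hs, h, rfl, rfl⟩, rfl⟩
      exact ⟨r, hr, s, hs, h, rfl⟩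

theorem rel_leUnitV_realV {r s : ℝ} :
    Rel leUnitV (realV r) (realV s) ↔ 0 ≤ r ∧ r ≤ s ∧ s ≤ 1 := by
  rw [rel_leUnitV]
  constructor
  · rintro ⟨r', s', h1, h2, h3, e1, e2⟩
    rw [realV_injective e1, realV_injective e2]
    exact ⟨h1, h2, h3⟩
  · rintro ⟨h1, h2, h3⟩
    exact ⟨r, s, h1, h2, h3, rfl, rfl⟩

/-- `f` contains `((a, b), c)`. -/
def Rel₂ {M : Type*} [setLang.Structure M] (f a b c : M) : Prop := ∃ p, IsPr p a b ∧ Rel f p c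

theorem rel₂_divV {x y z : V} :
    Rel₂ divV x y z ↔ ∃ k h : ℕ, k ≤ h ∧ 1 ≤ h ∧ x = natV k ∧ y = natV h ∧
      z = realV ((k : ℝ) / h) := by
  simp only [Rel₂]
  rw [divV]
  simp only [rel_toV_ofSet (n := 2) {p : Level 4 | ∃ k h : ℕ, k ≤ h ∧ 1 ≤ h ∧
    p = Level.pair (Level.pair (n := 0) k h) (Level.up 1 (realCode ((k : ℝ) / h)))}
    (fun a b => ∃ k h : ℕ, k ≤ h ∧ 1 ≤ h ∧
    a = Level.pair (n := 0) k h ∧ b = Level.up 1 (realCode ((k : ℝ) / h)))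
    (by
      intro p
      constructor
      · rintro ⟨k, h, h1, h2, rfl⟩
        exact ⟨_, _, ⟨k, h, h1, h2, rfl, rfl⟩, rfl⟩
      · rintro ⟨_, _, ⟨k, h, h1, h2, rfl, rfl⟩, rfl⟩
        exact ⟨k, h, h1, h2, rfl⟩)]
  constructor
  · rintro ⟨p, hp, _, _, ⟨k, h, h1, h2, rfl, rfl⟩, rfl, rfl⟩
    obtain ⟨rfl, rfl⟩ := hp.inj (isPr_toV_pair (n := 0) k h)
    exact ⟨k, h, h1, h2, rfl, rfl, Level.toV_up _⟩
  · rintro ⟨k, h, h1, h2, rfl, rfl, rfl⟩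
    exact ⟨_, isPr_toV_pair (n := 0) k h, _, _, ⟨k, h, h1, h2, rfl, rfl⟩, rfl,
      (Level.toV_up _).symm⟩

/-! ### Formulas with named variables -/

section Formulas

variable {M : Type*} [setLang.Structure M]

/-- The formula `xᵢ ∈ xⱼ`. -/
def memF (i j : ℕ) : setLang.Formula ℕ :=
  Language.Relations.formula₂ (L := setLang) MemRel.mem (Language.Term.var i) (Language.Term.var j)

/-- The formula `xᵢ = xⱼ`. -/
def eqF (i j : ℕ) : setLang.Formula ℕ :=
  Language.Term.equal (Language.Term.var i) (Language.Term.var j)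

/-- The formula `∀ xᵢ, φ`. -/
def allF (i : ℕ) (φ : setLang.Formula ℕ) : setLang.Formula ℕ :=
  (Language.BoundedFormula.relabel (n := 1)
    (fun k => if k = i then (Sum.inr 0 : ℕ ⊕ Fin 1) else Sum.inl k) φ).all

/-- The formula `∃ xᵢ, φ`. -/
def exF (i : ℕ) (φ : setLang.Formula ℕ) : setLang.Formula ℕ := (allF i φ.not).not

@[simp] theorem realize_memF (i j : ℕ) (v : ℕ → M) : (memF i j).Realize v ↔ E (v i) (v j) :=
  Language.Formula.realize_rel₂ (L := setLang) (R := MemRel.mem)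

@[simp] theorem realize_eqF (i j : ℕ) (v : ℕ → M) : (eqF i j).Realize v ↔ v i = v j := by
  simp [eqF, Language.Formula.realize_equal]

@[simp] theorem realize_allF (i : ℕ) (φ : setLang.Formula ℕ) (v : ℕ → M) :
    (allF i φ).Realize v ↔ ∀ a : M, φ.Realize (Function.update v i a) := by
  rw [allF, Language.Formula.Realize, Language.BoundedFormula.realize_all]
  refine forall_congr' fun a => ?_
  rw [Language.BoundedFormula.realize_relabel, Language.Formula.Realize, iff_iff_eq]
  congr 1
  · funext k
    by_cases h : k = i
    · subst h
      simp [Fin.snoc]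
    · simp [h]
  · exact Subsingleton.elim _ _

@[simp] theorem realize_exF (i : ℕ) (φ : setLang.Formula ℕ) (v : ℕ → M) :
    (exF i φ).Realize v ↔ ∃ a : M, φ.Realize (Function.update v i a) := by
  simp [exF]

/-- The formula saying that `x_p` is the pair `(x_a, x_b)`. -/
def isPrF (p a b : ℕ) : setLang.Formula ℕ :=
  exF 1000 (exF 1001 (allF 1002 ((memF 1002 1000).iff (eqF 1002 a)) ⊓
    (allF 1002 ((memF 1002 1001).iff (eqF 1002 a ⊔ eqF 1002 b)) ⊓
      allF 1002 ((memF 1002 p).iff (eqF 1002 1000 ⊔ eqF 1002 1001)))))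

-- The bound variables are named from 1000 upwards; a free variable with one of these names would be
-- captured.
@[simp] theorem realize_isPrF {p a b : ℕ} (v : ℕ → M) (hp : p ≠ 1000 ∧ p ≠ 1001 ∧ p ≠ 1002)
    (ha : a ≠ 1000 ∧ a ≠ 1001 ∧ a ≠ 1002) (hb : b ≠ 1000 ∧ b ≠ 1001 ∧ b ≠ 1002) :
    (isPrF p a b).Realize v ↔ IsPr (v p) (v a) (v b) := by
  obtain ⟨p0, p1, p2⟩ := hp
  obtain ⟨a0, a1, a2⟩ := ha
  obtain ⟨b0, b1, b2⟩ := hb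
  simp [isPrF, IsPr, *]

/-- The formula saying that `x_f` contains the pair `(x_a, x_b)`. -/
def relF (f a b : ℕ) : setLang.Formula ℕ := exF 1003 (isPrF 1003 a b ⊓ memF 1003 f)

@[simp] theorem realize_relF {f a b : ℕ} (v : ℕ → M) (hf : f ≠ 1003)
    (ha : a ≠ 1000 ∧ a ≠ 1001 ∧ a ≠ 1002 ∧ a ≠ 1003)
    (hb : b ≠ 1000 ∧ b ≠ 1001 ∧ b ≠ 1002 ∧ b ≠ 1003) :
    (relF f a b).Realize v ↔ Rel (v f) (v a) (v b) := by
  obtain ⟨a0, a1, a2, a3⟩ := ha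
  obtain ⟨b0, b1, b2, b3⟩ := hb
  simp [relF, Rel, *]

/-- The formula saying that `x_f` contains `((x_a, x_b), x_c)`. -/
def rel₂F (f a b c : ℕ) : setLang.Formula ℕ := exF 1004 (isPrF 1004 a b ⊓ relF f 1004 c)

@[simp] theorem realize_rel₂F {f a b c : ℕ} (v : ℕ → M) (hf : f < 1000) (ha : a < 1000)
    (hb : b < 1000) (hc : c < 1000) :
    (rel₂F f a b c).Realize v ↔ Rel₂ (v f) (v a) (v b) (v c) := by
  have h (k : ℕ) (hk : k < 1000) : k ≠ 1000 ∧ k ≠ 1001 ∧ k ≠ 1002 ∧ k ≠ 1003 ∧ k ≠ 1004 := by omega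
  obtain ⟨a0, a1, a2, a3, a4⟩ := h a ha
  obtain ⟨b0, b1, b2, b3, b4⟩ := h b hb
  obtain ⟨c0, c1, c2, c3, c4⟩ := h c hc
  obtain ⟨f0, f1, f2, f3, f4⟩ := h f hf
  simp [rel₂F, Rel₂, *]

end Formulas

/-- The assignment of parameters from a list. -/
noncomputable def env (l : List V) (i : ℕ) : V := l.getD i (natV 0)

@[simp] theorem env_zero (x : V) (l : List V) : env (x :: l) 0 = x := rfl
@[simp] theorem env_one (x y : V) (l : List V) : env (x :: y :: l) 1 = y := rfl
@[simp] theorem env_two (x y z : V) (l : List V) : env (x :: y :: z :: l) 2 = z := rfl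
@[simp] theorem env_three (x y z t : V) (l : List V) : env (x :: y :: z :: t :: l) 3 = t := rfl
@[simp] theorem env_four (x y z t w : V) (l : List V) :
    env (x :: y :: z :: t :: w :: l) 4 = w := rfl
@[simp] theorem env_five (x y z t w a : V) (l : List V) :
    env (x :: y :: z :: t :: w :: a :: l) 5 = a := rfl
@[simp] theorem env_six (x y z t w a b : V) (l : List V) :
    env (x :: y :: z :: t :: w :: a :: b :: l) 6 = b := rfl

/-! ### Transfer, and absoluteness of pairs for the truncation -/

namespace NonstandardUniverse

variable (U : NonstandardUniverse.{u})

/-- The transfer principle. -/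
theorem transfer (φ : setLang.Formula ℕ) (l : List V) (h : φ.Realize (env l)) :
    φ.Realize fun i => U.emb (env l i) :=
  (U.emb.map_formula φ (env l)).2 h

/-- Levels are transitive sets, and this transfers. Hence every element, in the sense of the
extension, of an internal set is internal. -/
theorem transitive_levelSet {n : ℕ} {x y : U.Ext} (hy : E y (U.emb (levelSet n))) (hx : E x y) :
    E x (U.emb (levelSet n)) := by
  have := U.transfer (allF 10 (allF 11 ((memF 11 0).imp ((memF 10 11).imp (memF 10 0)))))
    [levelSet n] (by
      simp
      intro x y hy hx
      obtain ⟨y, rfl⟩ := E_levelSet.1 hy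
      rcases n with _ | n
      · exact absurd hx (Level.not_E_natV _ _)
      rcases y with k | s
      · exact absurd hx (Level.not_E_inl _ _)
      · obtain ⟨w, -, rfl⟩ := (Level.E_toV_ofSet _ _).1 hx
        exact E_levelSet.2 ⟨_, (Level.toV_up w).symm⟩)
  simp at this
  exact this x y hy hx

theorem levelSet_succ {n : ℕ} {x : U.Ext} (hx : E x (U.emb (levelSet n))) :
    E x (U.emb (levelSet (n + 1))) := by
  have := U.transfer (allF 10 ((memF 10 0).imp (memF 10 1)))
    [levelSet n, levelSet (n + 1)] (by
      simp
      intro x hx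
      obtain ⟨x, rfl⟩ := E_levelSet.1 hx
      exact E_levelSet.2 ⟨_, (Level.toV_up x).symm⟩)
  simp at this
  exact this x hx

theorem levelSet_mono {m n : ℕ} (h : m ≤ n) {x : U.Ext} (hx : E x (U.emb (levelSet m))) :
    E x (U.emb (levelSet n)) := by
  induction h with
  | refl => exact hx
  | step _ ih => exact U.levelSet_succ ih

theorem exists_isPr {n : ℕ} {a b : U.Ext} (ha : E a (U.emb (levelSet n)))
    (hb : E b (U.emb (levelSet n))) : ∃ p, E p (U.emb (levelSet (n + 2))) ∧ IsPr p a b := by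
  have := U.transfer (allF 10 (allF 11 ((memF 10 0).imp ((memF 11 0).imp
    (exF 12 (memF 12 1 ⊓ isPrF 12 10 11)))))) [levelSet n, levelSet (n + 2)] (by
      simp
      intro a b ha hb
      obtain ⟨a, rfl⟩ := E_levelSet.1 ha
      obtain ⟨b, rfl⟩ := E_levelSet.1 hb
      exact ⟨_, E_levelSet.2 ⟨_, rfl⟩, isPr_toV_pair a b⟩)
  simp at this
  exact this a b ha hb

theorem isPr_unique {a b p q : U.Ext} (hp : IsPr p a b) (hq : IsPr q a b) : p = q := by
  have := U.transfer (allF 10 (allF 11 (allF 12 (allF 13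
    ((isPrF 12 10 11).imp ((isPrF 13 10 11).imp (eqF 12 13))))))) [] (by
      simp
      exact fun _ _ _ _ => IsPr.unique)
  simp at this
  exact this a b p q hp hq

variable {U}

theorem Carrier.ext {x y : U.Carrier} (h : x.1 = y.1) : x = y := Subtype.ext h

theorem exists_carrier {x : U.Ext} {y : U.Carrier} (h : E x y.1) : ∃ z : U.Carrier, z.1 = x := by
  obtain ⟨y, n, hy⟩ := y
  exact ⟨⟨x, n, U.transitive_levelSet hy h⟩, rfl⟩

/-- The truncation is closed under elements, so quantifiers over the elements of an internal set
mean the same in it and in the full extension. This lets transfer, which speaks of the extension, be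
applied to pairs formed in the truncation. -/
theorem isPair_iff {p a b : U.Carrier} : IsPair p a b ↔ IsPr p.1 a.1 b.1 := by
  constructor
  · rintro ⟨s, t, hs, ht, hp⟩
    have key {x : U.Carrier} {P : U.Ext → Prop} (h : ∀ w : U.Carrier, w ∈ x ↔ P w.1)
        (h' : ∀ w, P w → ∃ z : U.Carrier, z.1 = w) (w : U.Ext) : E w x.1 ↔ P w := by
      constructor
      · intro hw
        obtain ⟨z, rfl⟩ := exists_carrier hw
        exact (h z).1 hw
      · intro hw
        obtain ⟨z, rfl⟩ := h' w hw
        exact (h z).2 hw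
    refine ⟨s.1, t.1, key (P := fun w => w = a.1) (fun w => (hs w).trans Subtype.ext_iff) ?_,
      key (P := fun w => w = a.1 ∨ w = b.1)
        (fun w => (ht w).trans (or_congr Subtype.ext_iff Subtype.ext_iff)) ?_,
      key (P := fun w => w = s.1 ∨ w = t.1)
        (fun w => (hp w).trans (or_congr Subtype.ext_iff Subtype.ext_iff)) ?_⟩
    · rintro w rfl
      exact ⟨_, rfl⟩
    · rintro w (rfl | rfl) <;> exact ⟨_, rfl⟩
    · rintro w (rfl | rfl) <;> exact ⟨_, rfl⟩
  · rintro ⟨s, t, hs, ht, hp⟩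
    obtain ⟨s, rfl⟩ := exists_carrier ((hp _).2 (Or.inl rfl))
    obtain ⟨t, rfl⟩ := exists_carrier ((hp _).2 (Or.inr rfl))
    exact ⟨s, t, fun w => (hs w.1).trans Subtype.ext_iff.symm,
      fun w => (ht w.1).trans (or_congr Subtype.ext_iff.symm Subtype.ext_iff.symm),
      fun w => (hp w.1).trans (or_congr Subtype.ext_iff.symm Subtype.ext_iff.symm)⟩

/-- A pair of elements of rank at most $n$ lies two levels higher, so it survives the truncation and
the choice in `pr` is not a default value. -/
theorem isPr_pr (a b : U.Carrier) : IsPr (pr a b).1 a.1 b.1 := by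
  rw [← isPair_iff]
  apply Classical.epsilon_spec (p := fun p => IsPair p a b)
  obtain ⟨a, m, ha⟩ := a
  obtain ⟨b, n, hb⟩ := b
  obtain ⟨p, hp, h⟩ := U.exists_isPr (U.levelSet_mono (le_max_left m n) ha)
    (U.levelSet_mono (le_max_right m n) hb)
  exact ⟨⟨p, _, hp⟩, isPair_iff.2 h⟩

theorem pr_mem_iff {a b f : U.Carrier} : pr a b ∈ f ↔ Rel f.1 a.1 b.1 := by
  constructor
  · exact fun h => ⟨_, isPr_pr a b, h⟩
  · rintro ⟨p, hp, hf⟩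
    rw [U.isPr_unique hp (isPr_pr a b)] at hf
    exact hf

theorem rel_pr_iff {a b c f : U.Carrier} : Rel f.1 (pr a b).1 c.1 ↔ Rel₂ f.1 a.1 b.1 c.1 := by
  constructor
  · exact fun h => ⟨_, isPr_pr a b, h⟩
  · rintro ⟨p, hp, hf⟩
    rwa [U.isPr_unique hp (isPr_pr a b)] at hf

theorem rel_app {f x : U.Carrier} (h : ∃ y, Rel f.1 x.1 y) : Rel f.1 x.1 (app f x).1 := by
  rw [← pr_mem_iff]
  apply Classical.epsilon_spec (p := fun y => pr x y ∈ f)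
  obtain ⟨y, p, ⟨s, t, hs, ht, hp⟩, hf⟩ := h
  obtain ⟨p, rfl⟩ := exists_carrier hf
  obtain ⟨t, rfl⟩ := exists_carrier ((hp _).2 (Or.inr rfl))
  obtain ⟨y, rfl⟩ := exists_carrier ((ht y).2 (Or.inr rfl))
  exact ⟨y, pr_mem_iff.2 ⟨_, ⟨s, _, hs, ht, hp⟩, hf⟩⟩

end NonstandardUniverse

/-! ### Internal subsets of {1, …, h} and their internal probability -/

theorem finset_of_subset_Icc {s : Set ℕ} {h : ℕ} (hs : ∀ k ∈ s, 1 ≤ k ∧ k ≤ h) :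
    ∃ t : Finset ℕ, s = t ∧ t ⊆ Finset.Icc 1 h := by
  have hfin : s.Finite := (Set.finite_Icc 1 h).subset fun k hk => hs k hk
  exact ⟨hfin.toFinset, by simp, fun k hk => by simpa using hs k (by simpa using hk)⟩

theorem exists_finset_of_isSeg {b : V} {h : ℕ}
    (hb : E b powNatV) (hs : ∀ x : V, E x b → E x (levelSet 0) ∧ Rel leV (natV 1) x ∧
      Rel leV x (natV h)) :
    ∃ t : Finset ℕ, b = setV t ∧ t ⊆ Finset.Icc 1 h := by
  obtain ⟨s, rfl⟩ := E_powNatV.1 hb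
  obtain ⟨t, rfl, ht⟩ := finset_of_subset_Icc (s := s) (h := h) fun k hk => by
    have := (hs (natV k) (natV_E_setV.2 hk)).2
    rwa [leV_eq_relV, rel_relV_natV, rel_relV_natV] at this
  exact ⟨t, rfl, ht⟩

namespace NonstandardUniverse

variable (U : NonstandardUniverse.{u})

/-- The order of `*ℕ`. -/
abbrev Le (x y : U.Ext) : Prop := Rel (U.emb leV) x y

/-- The elements of `{1, …, h}`. -/
abbrev Seg (x h : U.Ext) : Prop :=
  E x (U.emb (levelSet 0)) ∧ U.Le (U.emb (natV 1)) x ∧ U.Le x h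

/-- `x` is an internal subset of `{1, …, h}`. -/
abbrev SubSeg (b h : U.Ext) : Prop :=
  E b (U.emb powNatV) ∧ ∀ x : U.Ext, E x b → U.Seg x h

/-- The formula saying that `x ∈ {1, …, h}`, with parameters `x₀ = ℕ`, `x₁` the order of `ℕ`,
and `x₂ = 1`. -/
def segF (x h : ℕ) : setLang.Formula ℕ := memF x 0 ⊓ (relF 1 2 x ⊓ relF 1 x h)

/-- The formula saying that `b ⊆ {1, …, h}` and `b ∈ 𝒫(ℕ)`, with the parameters above and
`x₃ = 𝒫(ℕ)`. -/
def subSegF (b h : ℕ) : setLang.Formula ℕ :=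
  memF b 3 ⊓ allF 50 ((memF 50 b).imp (segF 50 h))

theorem exists_diff {b c : U.Ext} (hb : E b (U.emb powNatV)) (hc : E c (U.emb powNatV)) :
    ∃ e, E e (U.emb powNatV) ∧ ∀ x, E x e ↔ E x b ∧ ¬ E x c := by
  have := U.transfer (allF 10 (allF 11 ((memF 10 0).imp ((memF 11 0).imp
    (exF 12 (memF 12 0 ⊓ allF 13 ((memF 13 12).iff (memF 13 10 ⊓ (memF 13 11).not))))))))
    [powNatV] (by
      simp
      intro b c hb hc
      obtain ⟨b, rfl⟩ := E_powNatV.1 hb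
      obtain ⟨c, rfl⟩ := E_powNatV.1 hc
      refine ⟨setV (b \ c), E_powNatV.2 ⟨_, rfl⟩, fun x => ?_⟩
      constructor
      · intro h
        obtain ⟨k, hk, rfl⟩ := E_setV.1 h
        simpa [natV_E_setV] using hk
      · rintro ⟨h1, h2⟩
        obtain ⟨k, hk, rfl⟩ := E_setV.1 h1
        exact natV_E_setV.2 ⟨hk, fun h => h2 (natV_E_setV.2 h)⟩)
  simp at this
  exact this b c hb hc

theorem exists_seg {h : U.Ext} (hh : E h (U.emb (levelSet 0))) :
    ∃ b, E b (U.emb powNatV) ∧ ∀ x, E x b ↔ U.Seg x h := by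
  have := U.transfer (allF 10 ((memF 10 0).imp (exF 11 (memF 11 3 ⊓
      allF 12 ((memF 12 11).iff (segF 12 10))))))
    [levelSet 0, leV, natV 1, powNatV] (by
      simp [segF]
      intro h hh
      obtain ⟨h, rfl⟩ := E_levelSet_zero.1 hh
      refine ⟨setV (Set.Icc 1 h), E_powNatV.2 ⟨_, rfl⟩, fun x => ?_⟩
      constructor
      · intro hx
        obtain ⟨k, hk, rfl⟩ := E_setV.1 hx
        simpa [leV_eq_relV, rel_relV_natV, E_levelSet_zero] using hk
      · rintro ⟨h1, h2⟩
        obtain ⟨k, rfl⟩ := E_levelSet_zero.1 h1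
        simpa [leV_eq_relV, rel_relV_natV, natV_E_setV] using h2)
  simp [segF] at this
  exact this h hh

theorem setV_diff (s t : Set ℕ) (x : U.Ext) :
    E x (U.emb (setV (s \ t))) ↔ E x (U.emb (setV s)) ∧ ¬ E x (U.emb (setV t)) := by
  have := U.transfer (allF 10 ((memF 10 0).iff (memF 10 1 ⊓ (memF 10 2).not)))
    [setV (s \ t), setV s, setV t] (by
      simp
      intro x
      constructor
      · intro h
        obtain ⟨k, hk, rfl⟩ := E_setV.1 h
        simpa [natV_E_setV] using hk
      · rintro ⟨h1, h2⟩
        obtain ⟨k, hk, rfl⟩ := E_setV.1 h1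
        exact natV_E_setV.2 ⟨hk, fun h => h2 (natV_E_setV.2 h)⟩)
  simp at this
  exact this x

theorem setV_powNatV (s : Set ℕ) : E (U.emb (setV s)) (U.emb powNatV) := by
  have := U.transfer (memF 0 1) [setV s, powNatV] (by simpa using E_powNatV.2 ⟨s, rfl⟩)
  simpa using this

/-- Induction on the standard `k`: a hypernatural number that is at least `k` and differs from `k`
is at least `k + 1`, by transfer. -/
theorem natV_le_of_ne (k : ℕ) {h : U.Ext} (hh : E h (U.emb (levelSet 0)))
    (hk : ∀ j : ℕ, h ≠ U.emb (natV j)) : U.Le (U.emb (natV k)) h := by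
  induction k with
  | zero =>
    have := U.transfer (allF 10 ((memF 10 0).imp (relF 1 2 10))) [levelSet 0, leV, natV 0] (by
      simp
      intro h hh
      obtain ⟨h, rfl⟩ := E_levelSet_zero.1 hh
      simp [leV_eq_relV, rel_relV_natV])
    simp at this
    exact this h hh
  | succ k ih =>
    have := U.transfer (allF 10 ((memF 10 0).imp ((relF 1 2 10).imp (eqF 10 2 ⊔ relF 1 3 10))))
      [levelSet 0, leV, natV k, natV (k + 1)] (by
        simp
        intro h hh
        obtain ⟨h, rfl⟩ := E_levelSet_zero.1 hh
        simp only [leV_eq_relV, rel_relV_natV]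
        intro hle
        rcases hle.eq_or_lt with rfl | h
        · exact Or.inl rfl
        · exact Or.inr h)
    simp at this
    exact (this h hh ih).resolve_left (hk k)

theorem exists_card {b h : U.Ext} (hh : E h (U.emb (levelSet 0))) (hb : U.SubSeg b h) :
    ∃ n, Rel (U.emb cardV) b n := by
  have := U.transfer (allF 10 ((memF 10 0).imp (allF 11 ((subSegF 11 10).imp
    (exF 12 (relF 4 11 12)))))) [levelSet 0, leV, natV 1, powNatV, cardV] (by
      simp [segF, subSegF]
      intro h hh b hb hs
      obtain ⟨h, rfl⟩ := E_levelSet_zero.1 hh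
      obtain ⟨t, rfl, ht⟩ := exists_finset_of_isSeg hb hs
      exact ⟨_, rel_cardV.2 ⟨t, rfl, rfl⟩⟩)
  simp [segF, subSegF] at this
  exact this h hh b hb.1 hb.2

theorem exists_div {b h n : U.Ext} (hh : E h (U.emb (levelSet 0)))
    (hh1 : U.Le (U.emb (natV 1)) h) (hb : U.SubSeg b h)
    (hn : Rel (U.emb cardV) b n) : ∃ q, Rel₂ (U.emb divV) n h q := by
  have := U.transfer (allF 10 ((memF 10 0).imp ((relF 1 2 10).imp (allF 11 ((subSegF 11 10).imp
    (allF 12 ((relF 4 11 12).imp (exF 13 (rel₂F 5 12 10 13)))))))))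
    [levelSet 0, leV, natV 1, powNatV, cardV, divV] (by
      simp [segF, subSegF]
      intro h hh h1 b hb hs n hn
      obtain ⟨h, rfl⟩ := E_levelSet_zero.1 hh
      rw [leV_eq_relV, rel_relV_natV] at h1
      obtain ⟨t, rfl, ht⟩ := exists_finset_of_isSeg hb hs
      obtain ⟨t', e, rfl⟩ := rel_cardV.1 hn
      obtain rfl : t = t' := Finset.coe_injective (setV_injective e)
      exact ⟨_, rel₂_divV.2 ⟨_, _, by simpa using Finset.card_le_card ht, h1, rfl, rfl, rfl⟩⟩)
  simp [segF, subSegF] at this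
  exact this h hh hh1 b hb.1 hb.2 n hn

/-- `q` is the quotient of the internal cardinality of `b` by `h`. -/
def Prob (b h q : U.Ext) : Prop := ∃ n, Rel (U.emb cardV) b n ∧ Rel₂ (U.emb divV) n h q

/-- The formula for `Prob`, with parameters `x₀` and `x₁` for the cardinality function and the
division function. -/
def probF (b h q : ℕ) : setLang.Formula ℕ := exF 60 (relF 0 b 60 ⊓ rel₂F 1 60 h q)

theorem exists_finset_of_prob {b h q : V} (hp : ∃ n, Rel cardV b n ∧ Rel₂ divV n h q) :
    ∃ (s : Finset ℕ) (k : ℕ), b = setV s ∧ h = natV k ∧ 1 ≤ k ∧ s.card ≤ k ∧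
      q = realV ((s.card : ℝ) / k) := by
  obtain ⟨n, h1, h2⟩ := hp
  obtain ⟨s, rfl, rfl⟩ := rel_cardV.1 h1
  obtain ⟨c, k, hck, hk, e, rfl, rfl⟩ := rel₂_divV.1 h2
  obtain rfl := Level.natV_injective e
  exact ⟨s, k, rfl, rfl, hk, hck, rfl⟩

theorem prob_nonneg {b h q : U.Ext} (hp : U.Prob b h q) :
    Rel (U.emb leUnitV) (U.emb (realV 0)) q := by
  have := U.transfer (allF 10 (allF 11 (allF 12 ((probF 10 11 12).imp (relF 2 3 12)))))
    [cardV, divV, leUnitV, realV 0] (by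
      simp [probF, -forall_exists_index]
      intro b h q hp
      obtain ⟨s, k, rfl, rfl, hk, hck, rfl⟩ := exists_finset_of_prob hp
      rw [rel_leUnitV_realV]
      have : (0 : ℝ) < k := by exact_mod_cast hk
      exact ⟨le_rfl, by positivity, by rw [div_le_one this]; exact_mod_cast hck⟩)
  simp [probF, -forall_exists_index] at this
  exact this b h q hp

theorem prob_le_one {r : ℝ} {q : U.Ext}
    (hr : Rel (U.emb leUnitV) (U.emb (realV r)) q) : r ≤ 1 := by
  by_contra hr1
  have := U.transfer (allF 10 (relF 0 1 10).not) [leUnitV, realV r] (by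
      simp
      intro q hq
      obtain ⟨r', s, h1, h2, h3, e, rfl⟩ := rel_leUnitV.1 hq
      rw [realV_injective e] at hr1
      exact hr1 (h2.trans h3))
  simp at this
  exact this q hr

/-- Superadditivity is phrased with standard lower bounds `r` and `s`, so that no addition on
$^*[0,1]$ is needed. In the standard universe it is the inequality $|b|+|c|\le|e|$ for disjoint
subsets $b, c$ of $e$. -/
theorem prob_add {b c e h q₁ q₂ q₃ : U.Ext} (h₁ : U.Prob b h q₁) (h₂ : U.Prob c h q₂)
    (h₃ : U.Prob e h q₃) (hbc : ∀ x, E x b → ¬ E x c) (hbe : ∀ x, E x b → E x e)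
    (hce : ∀ x, E x c → E x e) {r s : ℝ}
    (hr : Rel (U.emb leUnitV) (U.emb (realV r)) q₁)
    (hs : Rel (U.emb leUnitV) (U.emb (realV s)) q₂) :
    Rel (U.emb leUnitV) (U.emb (realV (r + s))) q₃ := by
  have := U.transfer (allF 10 (allF 11 (allF 12 (allF 13 (allF 14 (allF 15 (allF 16
    ((probF 10 13 14).imp ((probF 11 13 15).imp ((probF 12 13 16).imp
    ((allF 17 ((memF 17 10).imp (memF 17 11).not)).imp
    ((allF 17 ((memF 17 10).imp (memF 17 12))).imp
    ((allF 17 ((memF 17 11).imp (memF 17 12))).imp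
    ((relF 2 3 14).imp ((relF 2 4 15).imp (relF 2 5 16))))))))))))))))
    [cardV, divV, leUnitV, realV r, realV s, realV (r + s)] (by
      simp [probF, -forall_exists_index]
      intro b c e h q₁ q₂ q₃ h₁ h₂ h₃ hbc hbe hce hr hs
      obtain ⟨b, k, rfl, rfl, hk, hb, rfl⟩ := exists_finset_of_prob h₁
      obtain ⟨c, k', rfl, e', -, hc, rfl⟩ := exists_finset_of_prob h₂
      obtain rfl := Level.natV_injective e'
      obtain ⟨e, k', rfl, e', -, he, rfl⟩ := exists_finset_of_prob h₃
      obtain rfl := Level.natV_injective e'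
      rw [rel_leUnitV_realV] at hr hs ⊢
      have hk0 : (0 : ℝ) < k := by exact_mod_cast hk
      have hd : Disjoint b c := Finset.disjoint_left.2 fun x hx hx' =>
        hbc (natV x) (natV_E_setV.2 hx) (natV_E_setV.2 hx')
      have hsub : b ∪ c ⊆ e := Finset.union_subset
        (fun x hx => natV_E_setV.1 (hbe (natV x) (natV_E_setV.2 hx)))
        (fun x hx => natV_E_setV.1 (hce (natV x) (natV_E_setV.2 hx)))
      have hcard : b.card + c.card ≤ e.card := by
        rw [← Finset.card_union_of_disjoint hd]
        exact Finset.card_le_card hsub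
      have hcard' : (b.card : ℝ) + c.card ≤ e.card := by exact_mod_cast hcard
      refine ⟨add_nonneg hr.1 hs.1, (add_le_add hr.2.1 hs.2.1).trans ?_, ?_⟩
      · rw [← add_div]
        gcongr
      · rw [div_le_one hk0]
        exact_mod_cast he)
  simp [probF, -forall_exists_index] at this
  exact this b c e h q₁ q₂ q₃ h₁ h₂ h₃ hbc hbe hce hr hs

/-- On a residue class modulo `m` the quotient by `m` is injective, and it takes values in
$\{0,\dots,\lfloor h/m\rfloor\}$. -/
theorem card_le_of_modEq {t : Finset ℕ} {h m : ℕ} (ht : t ⊆ Finset.Icc 1 h)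
    (hmod : ∀ x ∈ t, ∀ y ∈ t, x % m = y % m) : t.card ≤ h / m + 1 := by
  have : t.card ≤ (Finset.range (h / m + 1)).card := by
    refine Finset.card_le_card_of_injOn (fun x => x / m) (fun x hx => ?_) fun x hx y hy hxy => ?_
    · have := (Finset.mem_Icc.1 (ht hx)).2
      simpa [Nat.lt_succ_iff] using Nat.div_le_div_right this
    · have h1 := hmod x hx y hy
      rw [← Nat.div_add_mod x m, ← Nat.div_add_mod y m, h1, show x / m = y / m from hxy]
  simpa using this

/-- An internal subset of `{1, …, h}` of numbers that are congruent modulo a standard `m` has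
internal probability at most `2 / m`. -/
theorem prob_le_of_modEq {m : ℕ} (hm : 0 < m) {R : Set ℕ}
    (hR : ∀ x ∈ R, ∀ y ∈ R, x % m = y % m) {b h q : U.Ext} (hh : E h (U.emb (levelSet 0)))
    (hmh : U.Le (U.emb (natV m)) h) (hb : U.SubSeg b h)
    (hbR : ∀ x, E x b → E x (U.emb (setV R))) (hp : ∃ n, Rel (U.emb cardV) b n ∧
      Rel₂ (U.emb divV) n h q) {r : ℝ}
    (hr : Rel (U.emb leUnitV) (U.emb (realV r)) q) : r ≤ 2 / m := by
  by_contra hrm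
  have := U.transfer (allF 10 ((memF 10 0).imp (allF 11 ((subSegF 11 10).imp
    ((relF 1 4 10).imp ((allF 12 ((memF 12 11).imp (memF 12 5))).imp
    (allF 13 (allF 14 ((relF 6 11 13).imp ((rel₂F 7 13 10 14).imp (relF 8 9 14).not))))))))))
    [levelSet 0, leV, natV 1, powNatV, natV m, setV R, cardV, divV, leUnitV, realV r] (by
      simp [segF, subSegF]
      change ∀ h : V, E h (levelSet 0) → ∀ b : V, E b powNatV → (∀ x : V, E x b →
        E x (levelSet 0) ∧ Rel leV (natV 1) x ∧ Rel leV x h) → Rel leV (natV m) h →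
        (∀ x : V, E x b → E x (setV R)) → ∀ n q : V, Rel cardV b n → Rel₂ divV n h q →
        ¬ Rel leUnitV (realV r) q
      intro h hh b hb hs hmh hbR n q h1 h2 hr
      obtain ⟨s, k, rfl, rfl, hk, hck, rfl⟩ := exists_finset_of_prob ⟨n, h1, h2⟩
      obtain ⟨t, e, ht⟩ := exists_finset_of_isSeg hb hs
      obtain rfl : s = t := Finset.coe_injective (setV_injective e)
      rw [leV_eq_relV, rel_relV_natV] at hmh
      rw [rel_leUnitV_realV] at hr
      have hc := card_le_of_modEq ht fun x hx y hy =>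
        hR x (natV_E_setV.1 (hbR (natV x) (natV_E_setV.2 hx))) y
          (natV_E_setV.1 (hbR (natV y) (natV_E_setV.2 hy)))
      have hm0 : (0 : ℝ) < m := by exact_mod_cast hm
      have hk0 : (0 : ℝ) < k := by exact_mod_cast hk
      apply hrm
      refine hr.2.1.trans ?_
      -- The factor 2 absorbs the extra 1 in the count, because `m ≤ k`.
      have hc1 : s.card * m ≤ 2 * k := by
        calc s.card * m ≤ (k / m + 1) * m := Nat.mul_le_mul_right _ hc
          _ = k / m * m + m := by ring
          _ ≤ k + k := add_le_add (Nat.div_mul_le_self k m) hmh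
          _ = 2 * k := by ring
      rw [div_le_div_iff₀ hk0 hm0]
      exact_mod_cast hc1)
  simp [segF, subSegF] at this
  obtain ⟨n, h1, h2⟩ := hp
  exact this h hh b hb.1 hb.2 hmh hbR n q h1 h2 hr

/-- Hyperfinite subsets of `*ℕ` are coded by hypernatural numbers. -/
theorem exists_code : ∃ c : U.Ext, ∀ h b : U.Ext, E h (U.emb (levelSet 0)) → U.SubSeg b h →
    ∃ k, E k (U.emb (levelSet 0)) ∧ ∀ x, E x b ↔ Rel c k x := by
  refine ⟨U.emb (relV fun k x => x ∈ (Denumerable.eqv (Finset ℕ)).symm k), ?_⟩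
  have := U.transfer (allF 10 (allF 11 ((memF 10 0).imp ((subSegF 11 10).imp
    (exF 12 (memF 12 0 ⊓ allF 13 ((memF 13 11).iff (relF 4 12 13))))))))
    [levelSet 0, leV, natV 1, powNatV,
      relV fun k x => x ∈ (Denumerable.eqv (Finset ℕ)).symm k] (by
      simp [segF, subSegF,]
      intro h b hh hb hs
      obtain ⟨h, rfl⟩ := E_levelSet_zero.1 hh
      obtain ⟨t, rfl, ht⟩ := exists_finset_of_isSeg hb hs
      refine ⟨natV (Denumerable.eqv (Finset ℕ) t), E_levelSet_zero.2 ⟨_, rfl⟩, fun x => ?_⟩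
      rw [E_setV, rel_relV]
      constructor
      · rintro ⟨k, hk, rfl⟩
        exact ⟨_, k, by rw [Equiv.symm_apply_apply]; exact hk, rfl, rfl⟩
      · rintro ⟨a, k, hk, e, rfl⟩
        rw [← Level.natV_injective e, Equiv.symm_apply_apply] at hk
        exact ⟨k, hk, rfl⟩)
  simp [segF, subSegF] at this
  intro h b hh hb
  exact this h b hh hb.1 hb.2

end NonstandardUniverse

/-! ### Compactness from the continuum hypothesis -/

theorem mk_nat_arrow_le (hCH : continuum.{0} = aleph 1) {J : Type u} (hJ : #J ≤ aleph 1) :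
    #(ℕ → J) ≤ aleph 1 := by
  have hCH' : continuum.{u} = aleph 1 := by
    have := congrArg Cardinal.lift.{u} hCH
    simpa using this
  rw [← hCH'] at hJ ⊢
  calc #(ℕ → J) = #J ^ (ℵ₀ : Cardinal.{u}) := by simp
    _ ≤ continuum ^ (ℵ₀ : Cardinal.{u}) := Cardinal.power_le_power_right hJ
    _ = continuum := Cardinal.continuum_power_aleph0

theorem mk_nat_bool (hCH : continuum.{0} = aleph 1) :
    #(ULift.{u} (ℕ → Bool)) = aleph 1 := by
  have := congrArg Cardinal.lift.{u} hCH
  simpa using this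

section Cylinders

variable {X : Type u}

/-- The set of points whose image under `f` agrees with `p` before `n`. -/
def cyl {X : Type*} (f : X → ℕ → Bool) (p : ℕ → Bool) (n : ℕ) : Set X :=
  {x | ∀ i < n, f x i = p i}

/-- Split `δ` into a summable family of positive numbers, one for each point of `Q`, and take the
cylinder around each point small enough for its share. -/
theorem exists_levels [MeasurableSpace X] (μ : Measure X) (f : X → ℕ → Bool)
    (hsmall : ∀ p, ∀ ε : ENNReal, ε ≠ 0 → ∃ n, μ (cyl f p n) ≤ ε)
    {Q : Set (ℕ → Bool)} (hQ : Q.Countable) {δ : ENNReal} (hδ : δ ≠ 0) :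
    ∃ N : (ℕ → Bool) → ℕ, μ (⋃ p ∈ Q, cyl f p (N p)) ≤ δ := by
  have := hQ.to_subtype
  obtain ⟨ε, hε, hsum⟩ := ENNReal.exists_pos_sum_of_countable' hδ Q
  choose M hM using fun p : Q => hsmall p.1 (ε p) (hε p).ne'
  classical
  refine ⟨fun p => if h : p ∈ Q then M ⟨p, h⟩ else 0, ?_⟩
  rw [Set.biUnion_eq_iUnion]
  refine (measure_iUnion_le _).trans (le_trans (ENNReal.tsum_le_tsum fun p => ?_) hsum.le)
  simpa using hM p

theorem isClosed_avoid (Q : Set (ℕ → Bool)) (N : (ℕ → Bool) → ℕ) :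
    IsClosed (⋂ p ∈ Q, (cyl id p (N p))ᶜ) := by
  refine isClosed_biInter fun p _ => IsOpen.isClosed_compl ?_
  have : cyl id p (N p) = ⋂ i ∈ Finset.range (N p), {s : ℕ → Bool | s i = p i} := by
    ext s
    simp [cyl]
  rw [this]
  refine isOpen_biInter_finset fun i _ => ?_
  have : Continuous fun s : ℕ → Bool => s i := continuous_apply i
  exact (isOpen_discrete {p i}).preimage this

/-- Under the continuum hypothesis, a measure space that is inner regular with respect to the
countable intersections of a countably compact family of at most `ℵ₁` measurable sets is compact,
provided that it has a map to the Cantor space with null fibres for which the complements of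
preimages of cylinders belong to the family. -/
theorem isCompactMeasureSpace_of_cantor (hCH : continuum.{0} = aleph 1) [MeasurableSpace X]
    (μ : Measure X) (J : Set (Set X)) (hJ : ∀ s ∈ J, MeasurableSet s) (hcard : #J ≤ aleph 1)
    (hsat : ∀ F : Set (Set X), F ⊆ J → F.Countable →
      (∀ F₀ : Set (Set X), F₀ ⊆ F → F₀.Finite → (⋂₀ F₀).Nonempty) → (⋂₀ F).Nonempty)
    (hinner : ∀ A : Set X, MeasurableSet A → ∀ ε : ENNReal, ε ≠ 0 → ∃ c : ℕ → Set X,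
      (∀ k, c k ∈ J) ∧ ⋂ k, c k ⊆ A ∧ μ (A \ ⋂ k, c k) ≤ ε)
    (f : X → ℕ → Bool) (hf : ∀ p n, (cyl f p n)ᶜ ∈ J)
    (hsmall : ∀ p, ∀ ε : ENNReal, ε ≠ 0 → ∃ n, μ (cyl f p n) ≤ ε) :
    IsCompactMeasureSpace μ := by
  classical
  -- The well-order $\omega_1$, in which both the indices and the points of the Cantor space are
  -- placed; its initial segments are countable.
  let W := (aleph 1 : Cardinal.{u}).ord.ToType
  have hW : #W = aleph 1 := by simp [W]
  have hIio (w : W) : (Set.Iio w).Countable := by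
    rw [← Cardinal.le_aleph0_iff_set_countable, ← Cardinal.lt_aleph_one_iff]
    exact (mk_Iio_lt w (by simp [W])).trans_eq hW
  have hIic (w : W) : (Set.Iic w).Countable := by
    rw [← Set.Iio_insert]
    exact (hIio w).insert w
  have hIdx : #((ℕ → J) × ℕ) ≤ #W := by
    rw [hW, mk_prod]
    refine (mul_le_mul' ((Cardinal.lift_uzero _).trans_le (mk_nat_arrow_le hCH hcard))
      (show Cardinal.lift.{u} #ℕ ≤ aleph 1 by simp)).trans ?_
    rw [Cardinal.mul_eq_self (Cardinal.aleph0_le_aleph 1)]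
  obtain ⟨eI⟩ := Cardinal.le_def _ _ |>.1 hIdx
  obtain ⟨eP⟩ := Cardinal.le_def _ _ |>.1 ((mk_nat_bool.{u} hCH).trans hW.symm).le
  let Q (i : (ℕ → J) × ℕ) : Set (ℕ → Bool) := {p | eP ⟨p⟩ < eI i}
  have hQ (i) : (Q i).Countable :=
    (hIio (eI i)).preimage (eP.injective.comp ULift.up_injective)
  -- For `i.2 = 0` the bound is `⊤` and says nothing; inner regularity uses only large `i.2`.
  choose N hN using fun i => exists_levels μ f hsmall (hQ i)
    (δ := ((i.2 : ENNReal))⁻¹) (by simp)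
  let S (i : (ℕ → J) × ℕ) : Set (Set X) :=
    Set.range (fun k => (i.1 k : Set X)) ∪ (fun p => (cyl f p (N i p))ᶜ) '' Q i
  have hSJ (i) : S i ⊆ J := by
    rintro _ (⟨k, rfl⟩ | ⟨p, -, rfl⟩)
    · exact (i.1 k).2
    · exact hf _ _
  have hSc (i) : (S i).Countable := (Set.countable_range _).union ((hQ i).image _)
  let C (i : (ℕ → J) × ℕ) : Set X := ⋂₀ S i
  have hCm (i) : MeasurableSet (C i) := .sInter (hSc i) fun s hs => hJ s (hSJ i hs)
  refine ⟨Set.range C, ?_, ?_, ?_⟩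
  · rintro _ ⟨i, rfl⟩
    exact hCm i
  · intro 𝒟 h𝒟 hfip
    let I := C ⁻¹' 𝒟
    have hfin (T : Set ((ℕ → J) × ℕ)) (hT : T ⊆ I) (hTf : T.Finite) :
        ∃ x, ∀ i ∈ T, x ∈ C i := by
      obtain ⟨x, hx⟩ := hfip (C '' T) (Set.image_subset_iff.2 hT) (hTf.image C)
      exact ⟨x, fun i hi => hx _ ⟨i, hi, rfl⟩⟩
    -- `f` maps `C i` into the closed set of sequences that avoid the cylinders of index `i`. These
    -- closed sets inherit the finite intersection property, so compactness gives a common point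
    -- `s`.
    have hIc : I.Countable := by
      obtain ⟨s, -, hs⟩ := isCompact_univ.inter_iInter_nonempty
        (fun i : I => ⋂ p ∈ Q i, (cyl id p (N i p))ᶜ) (fun i => isClosed_avoid _ _) (by
          intro u
          obtain ⟨x, hx⟩ := hfin ((↑) '' (u : Set I)) (by simp) (u.finite_toSet.image _)
          refine ⟨f x, trivial, ?_⟩
          simp only [Set.mem_iInter]
          intro i hi p hp
          exact hx i ⟨i, hi, rfl⟩ _ (Or.inr ⟨p, hp, rfl⟩))
      -- If `s` came before `i`, a cylinder around `s` itself would have been removed at index `i`.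
      -- So all indices in `I` are at most the position of `s`.
      refine ((hIic (eP ⟨s⟩)).preimage eI.injective).mono fun i hi => ?_
      simp only [Set.mem_iInter] at hs
      by_contra h
      have hlt : eP ⟨s⟩ < eI i := not_le.1 h
      exact hs ⟨i, hi⟩ s hlt fun _ _ => rfl
    -- All constituents of the sets `C i` together form a countable family. Finitely many of them
    -- meet, because each contains some `C i` with `i ∈ I`.
    obtain ⟨x, hx⟩ := hsat (⋃ i ∈ I, S i) (Set.iUnion₂_subset fun i _ => hSJ i)
      (hIc.biUnion fun i _ => hSc i) (by
        intro F₀ hF₀ hF₀f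
        have : ∀ a : F₀, ∃ i ∈ I, a.1 ∈ S i := fun a => by simpa using hF₀ a.2
        choose g hgI hg using this
        have := hF₀f.to_subtype
        obtain ⟨x, hx⟩ := hfin (Set.range g) (Set.range_subset_iff.2 hgI) (Set.finite_range g)
        exact ⟨x, fun a ha => hx _ ⟨⟨a, ha⟩, rfl⟩ a (hg ⟨a, ha⟩)⟩)
    refine ⟨x, fun D hD => ?_⟩
    obtain ⟨i, rfl⟩ := h𝒟 hD
    exact fun s hs => hx s (Set.mem_biUnion (show i ∈ I from hD) hs)
  · intro A hA
    refine ⟨?_, fun b hb => ENNReal.le_of_forall_pos_le_add fun ε hε _ => ?_⟩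
    · rintro _ ⟨D, ⟨-, hD⟩, rfl⟩
      exact measure_mono hD
    · have hε2 : (ε / 2 : ENNReal) ≠ 0 := by simpa using hε.ne'
      obtain ⟨c, hcJ, hcA, hc⟩ := hinner A hA (ε / 2) hε2
      -- One half of `ε` pays for the approximation of `A` by the sequence `c`, the other for the
      -- removed cylinders.
      obtain ⟨n, hn⟩ := ENNReal.exists_inv_nat_lt hε2
      let i : (ℕ → J) × ℕ := (fun k => ⟨c k, hcJ k⟩, n)
      have hCA : C i ⊆ A := fun x hx => hcA <| Set.mem_iInter.2 fun k => hx _ (Or.inl ⟨k, rfl⟩)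
      have hdiff : A \ C i ⊆ (A \ ⋂ k, c k) ∪ ⋃ p ∈ Q i, cyl f p (N i p) := by
        rintro x ⟨hxA, hx⟩
        by_contra h
        simp only [Set.mem_union, Set.mem_sdiff, hxA, true_and, not_or, not_not,
          Set.mem_iUnion, not_exists, Set.mem_iInter] at h
        refine hx ?_
        rintro _ (⟨k, rfl⟩ | ⟨p, hp, rfl⟩)
        · exact h.1 k
        · exact h.2 p hp
      calc μ A ≤ μ (C i ∪ A \ C i) := measure_mono (by simp)
        _ ≤ μ (C i) + (μ (A \ ⋂ k, c k) + μ (⋃ p ∈ Q i, cyl f p (N i p))) :=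
          (measure_union_le _ _).trans
            (add_le_add_right ((measure_mono hdiff).trans (measure_union_le _ _)) _)
        _ ≤ b + (ε / 2 + ε / 2) :=
          add_le_add (hb ⟨C i, ⟨⟨i, rfl⟩, hCA⟩, rfl⟩) (add_le_add hc ((hN i).trans hn.le))
        _ = b + ε := by rw [ENNReal.add_halves]

end Cylinders

/-! ### The Loeb measure and the algebra of internal sets -/

namespace NonstandardUniverse

variable {U : NonstandardUniverse.{u}} (H : U.Hypernat)

theorem isInternalSubset_iff {a : U.Carrier} : IsInternalSubset H a ↔ U.SubSeg a.1 H.1.1 := by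
  refine and_congr Iff.rfl ⟨fun h x hx => ?_, fun h x hx => ?_⟩
  · obtain ⟨x, rfl⟩ := exists_carrier hx
    obtain ⟨⟨⟨y, hyN⟩, hy⟩, rfl⟩ := h x hx
    exact ⟨hyN, pr_mem_iff.1 hy.1, pr_mem_iff.1 hy.2⟩
  · obtain ⟨h0, h1, h2⟩ := h x.1 hx
    exact ⟨⟨⟨x, h0⟩, pr_mem_iff.2 h1, pr_mem_iff.2 h2⟩, rfl⟩

theorem seg_of_Omega (x : Omega H) : U.Seg x.1.1.1 H.1.1 :=
  ⟨x.1.2, pr_mem_iff.1 x.2.1, pr_mem_iff.1 x.2.2⟩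

theorem isHyperfinite_le {H : U.Hypernat} (hH : U.IsHyperfinite H) (k : ℕ) :
    U.Le (U.emb (natV k)) H.1.1 :=
  U.natV_le_of_ne k H.2 fun j h => hH j (Carrier.ext h)

theorem prob_internalProb {H : U.Hypernat} (hH : U.IsHyperfinite H) {a : U.Carrier}
    (ha : IsInternalSubset H a) : U.Prob a.1 H.1.1 (internalProb H a).1 := by
  rw [isInternalSubset_iff] at ha
  have h1 : Rel (U.emb cardV) a.1 (icard a).1 :=
    rel_app (f := U.star cardV) (U.exists_card H.2 ha)
  refine ⟨_, h1, ?_⟩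
  obtain ⟨q, hq⟩ := U.exists_div H.2 (isHyperfinite_le hH 1) ha h1
  obtain ⟨p, hp, hpq⟩ := hq
  rw [U.isPr_unique hp (isPr_pr _ _)] at hpq
  exact rel_pr_iff.1 (rel_app (f := U.star divV) ⟨q, hpq⟩)

/-- The real numbers `r` with `*r ≤ x`. -/
def cut (x : U.Carrier) : Set ℝ := {r | Rel (U.emb leUnitV) (U.emb (realV r)) x.1}

theorem st_eq {x : U.Carrier} : st x = sSup {r | r ∈ Set.Icc (0 : ℝ) 1 ∧ r ∈ cut x} := by
  rw [st]
  congr 1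
  ext r
  exact and_congr Iff.rfl pr_mem_iff

theorem bddAbove_cut (x : U.Carrier) : BddAbove {r | r ∈ Set.Icc (0 : ℝ) 1 ∧ r ∈ cut x} :=
  ⟨1, fun _ hr => hr.1.2⟩

theorem st_nonneg (x : U.Carrier) : 0 ≤ st x := by
  rw [st_eq]
  exact Real.sSup_nonneg fun _ hr => hr.1.1

theorem st_le {x : U.Carrier} {b : ℝ} (hb : 0 ≤ b) (h : ∀ r ∈ cut x, r ≤ b) : st x ≤ b := by
  rw [st_eq]
  exact Real.sSup_le (fun r hr => h r hr.2) hb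

theorem st_le_one (x : U.Carrier) : st x ≤ 1 :=
  st_le zero_le_one fun _ hr => U.prob_le_one hr

/-- Superadditivity of the standard part of the internal probability. -/
theorem st_internalProb_add_le {H : U.Hypernat} (hH : U.IsHyperfinite H) {b c e : U.Carrier}
    (hb : IsInternalSubset H b) (hc : IsInternalSubset H c) (he : IsInternalSubset H e)
    (hbc : ∀ x, E x b.1 → ¬ E x c.1) (hbe : ∀ x, E x b.1 → E x e.1)
    (hce : ∀ x, E x c.1 → E x e.1) :
    st (internalProb H b) + st (internalProb H c) ≤ st (internalProb H e) := by
  have h0 {a : U.Carrier} (ha : IsInternalSubset H a) :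
      {r | r ∈ Set.Icc (0 : ℝ) 1 ∧ r ∈ cut (internalProb H a)}.Nonempty :=
    ⟨0, by simp, U.prob_nonneg (prob_internalProb hH ha)⟩
  rw [← le_sub_iff_add_le, st_eq (x := internalProb H b)]
  refine csSup_le (h0 hb) fun r hr => ?_
  rw [le_sub_comm, st_eq (x := internalProb H c)]
  refine csSup_le (h0 hc) fun s hs => ?_
  rw [le_sub_iff_add_le', st_eq]
  have h := U.prob_add (prob_internalProb hH hb) (prob_internalProb hH hc)
    (prob_internalProb hH he) hbc hbe hce hr.2 hs.2
  exact le_csSup (bddAbove_cut _)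
    ⟨⟨add_nonneg hr.1.1 hs.1.1, U.prob_le_one h⟩, h⟩

/-- The internal subsets of `{1, …, H}`, as sets. -/
def internalSets : Set (Set (Omega H)) := {A | ∃ a, IsInternalSubset H a ∧ extent H a = A}

/-- The set removed may be any element of $^*\mathcal P(\mathbb N)$, not only a subset of $\Omega$,
so that extensions of standard sets can be cut out too. -/
theorem exists_internal_diff {H : U.Hypernat} {a : U.Carrier} (ha : IsInternalSubset H a)
    {c : U.Ext} (hc : E c (U.emb powNatV)) :
    ∃ e : U.Carrier, IsInternalSubset H e ∧ ∀ x, E x e.1 ↔ E x a.1 ∧ ¬ E x c := by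
  obtain ⟨e, he, hx⟩ := U.exists_diff ha.1 hc
  obtain ⟨e, rfl⟩ := exists_carrier (y := U.star powNatV) he
  rw [isInternalSubset_iff] at ha
  exact ⟨e, (isInternalSubset_iff H).2 ⟨he, fun x h => ha.2 x ((hx x).1 h).1⟩, hx⟩

theorem exists_internal_univ :
    ∃ a : U.Carrier, IsInternalSubset H a ∧ ∀ x, E x a.1 ↔ U.Seg x H.1.1 := by
  obtain ⟨a, ha, hx⟩ := U.exists_seg H.2
  obtain ⟨a, rfl⟩ := exists_carrier (y := U.star powNatV) ha
  exact ⟨a, (isInternalSubset_iff H).2 ⟨ha, fun x h => (hx x).1 h⟩, hx⟩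

theorem extent_eq_univ {H : U.Hypernat} {a : U.Carrier} (ha : ∀ x, E x a.1 ↔ U.Seg x H.1.1) :
    extent H a = Set.univ :=
  Set.eq_univ_of_forall fun x => (ha _).2 (seg_of_Omega H x)

theorem univ_mem_internalSets : Set.univ ∈ internalSets H := by
  obtain ⟨a, ha, hx⟩ := exists_internal_univ H
  exact ⟨a, ha, extent_eq_univ hx⟩

theorem diff_mem_internalSets {H : U.Hypernat} {A B : Set (Omega H)} (hA : A ∈ internalSets H)
    (hB : B ∈ internalSets H) : A \ B ∈ internalSets H := by
  obtain ⟨a, ha, rfl⟩ := hA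
  obtain ⟨b, hb, rfl⟩ := hB
  obtain ⟨e, he, hx⟩ := exists_internal_diff ha hb.1
  exact ⟨e, he, Set.ext fun x => hx _⟩

theorem compl_mem_internalSets {H : U.Hypernat} {A : Set (Omega H)} (hA : A ∈ internalSets H) :
    Aᶜ ∈ internalSets H := by
  rw [Set.compl_eq_univ_sdiff]
  exact diff_mem_internalSets (univ_mem_internalSets H) hA

theorem empty_mem_internalSets : ∅ ∈ internalSets H := by
  simpa using compl_mem_internalSets (univ_mem_internalSets H)

open Classical in
/-- The set function that generates the Loeb outer measure. -/
noncomputable def weight (A : Set (Omega H)) : ENNReal :=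
  ⨅ (a : U.Carrier) (_ : IsInternalSubset H a ∧ extent H a = A),
    ENNReal.ofReal (st (internalProb H a))

theorem loebOuter_eq : loebOuter H = OuterMeasure.boundedBy (weight H) := rfl

theorem weight_extent_le {H : U.Hypernat} {a : U.Carrier} (ha : IsInternalSubset H a) :
    weight H (extent H a) ≤ ENNReal.ofReal (st (internalProb H a)) :=
  iInf₂_le a ⟨ha, rfl⟩

theorem mem_internalSets_of_weight {H : U.Hypernat} {A : Set (Omega H)} (hA : weight H A ≠ ⊤) :
    A ∈ internalSets H := by
  by_contra h
  exact hA (iInf₂_eq_top.2 fun a ha => absurd ⟨a, ha⟩ h)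

/-- The Carathéodory condition need only be tested on the generating set function, which is `⊤` off
the internal sets. On an internal test set it is superadditivity of $\mathrm{st}\circ P$. -/
theorem measurableSet_of_internal {H : U.Hypernat} (hH : U.IsHyperfinite H) {A : Set (Omega H)}
    (hA : A ∈ internalSets H) : MeasurableSet A := by
  obtain ⟨a, ha, rfl⟩ := hA
  refine OuterMeasure.boundedBy_caratheodory (m := weight H) fun T => ?_
  refine le_iInf₂ fun t ht => ?_
  obtain ⟨ht, rfl⟩ := ht
  obtain ⟨c, hc, hcx⟩ := exists_internal_diff ht ha.1
  obtain ⟨b, hb, hbx⟩ := exists_internal_diff ht hc.1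
  have e1 : extent H t \ extent H a = extent H c := Set.ext fun x => (hcx _).symm
  have e2 : extent H t ∩ extent H a = extent H b := by
    rw [← Set.sdiff_sdiff_right_self, e1]
    exact Set.ext fun x => (hbx _).symm
  rw [e1, e2]
  refine (add_le_add (weight_extent_le hb) (weight_extent_le hc)).trans ?_
  rw [← ENNReal.ofReal_add (st_nonneg _) (st_nonneg _)]
  exact ENNReal.ofReal_le_ofReal (st_internalProb_add_le hH hb hc ht
    (fun x h => ((hbx x).1 h).2) (fun x h => ((hbx x).1 h).1) fun x h => ((hcx x).1 h).1)

theorem loebMeasure_apply {A : Set (Omega H)} (hA : MeasurableSet A) :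
    loebMeasure H A = loebOuter H A := toMeasure_apply _ _ hA

theorem loebOuter_ne_top (A : Set (Omega H)) : loebOuter H A ≠ ⊤ := by
  obtain ⟨a, ha, hx⟩ := exists_internal_univ H
  have h : loebOuter H A ≤ ENNReal.ofReal 1 := calc
    loebOuter H A ≤ loebOuter H (extent H a) :=
      measure_mono (by rw [extent_eq_univ hx]; exact Set.subset_univ _)
    _ ≤ weight H (extent H a) := OuterMeasure.boundedBy_le _
    _ ≤ ENNReal.ofReal (st (internalProb H a)) := weight_extent_le ha
    _ ≤ ENNReal.ofReal 1 := ENNReal.ofReal_le_ofReal (st_le_one _)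
  exact ne_top_of_le_ne_top ENNReal.ofReal_ne_top h

/-- Inner approximation of Loeb measurable sets by countable intersections of internal sets. -/
theorem exists_inner {H : U.Hypernat} (hH : U.IsHyperfinite H) {A : Set (Omega H)}
    (hA : MeasurableSet A) {ε : ENNReal} (hε : ε ≠ 0) : ∃ c : ℕ → Set (Omega H),
      (∀ k, c k ∈ internalSets H) ∧ ⋂ k, c k ⊆ A ∧ loebMeasure H (A \ ⋂ k, c k) ≤ ε := by
  have hlt : loebOuter H Aᶜ < loebOuter H Aᶜ + ε :=
    ENNReal.lt_add_right (loebOuter_ne_top H _) hε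
  conv_lhs at hlt => rw [loebOuter_eq, OuterMeasure.boundedBy_apply]
  simp only [iInf_lt_iff] at hlt
  obtain ⟨t, hcov, hsum⟩ := hlt
  -- A nonempty piece of the cover has finite weight and so is internal. Empty pieces count as 0 in
  -- the sum whatever their weight and are treated apart.
  have htJ (n) : t n ∈ internalSets H := by
    rcases (t n).eq_empty_or_nonempty with h | h
    · rw [h]
      exact empty_mem_internalSets H
    · refine mem_internalSets_of_weight ?_
      have := ENNReal.ne_top_of_tsum_ne_top hsum.ne_top n
      simpa [h] using this
  have htm (n) : MeasurableSet (t n) := measurableSet_of_internal hH (htJ n)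
  -- The complements of a nearly optimal internal cover of `Aᶜ` approximate `A` from inside; the
  -- error is the excess of the cover over `Aᶜ`.
  refine ⟨fun n => (t n)ᶜ, fun n => compl_mem_internalSets (htJ n), ?_, ?_⟩
  · rw [← Set.compl_iUnion]
    exact Set.compl_subset_comm.1 hcov
  · have e : A \ ⋂ n, (t n)ᶜ = (⋃ n, t n) \ Aᶜ := by
      rw [← Set.compl_iUnion]
      ext x
      simp [and_comm]
    have hAc : loebMeasure H Aᶜ = loebOuter H Aᶜ := loebMeasure_apply H hA.compl
    rw [e, measure_sdiff hcov hA.compl.nullMeasurableSet (by rw [hAc]; exact loebOuter_ne_top H _),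
      tsub_le_iff_left, hAc]
    refine le_trans ((measure_iUnion_le _).trans (ENNReal.tsum_le_tsum fun n => ?_)) hsum.le
    rw [loebMeasure_apply H (htm n)]
    rcases (t n).eq_empty_or_nonempty with h | h
    · simp [h]
    · simpa [h, loebOuter_eq] using OuterMeasure.boundedBy_le (m := weight H) (t n)

theorem sInter_nonempty_of_isSaturated (hsat : U.IsSaturated (aleph 1))
    (F : Set (Set (Omega H))) (hF : F ⊆ internalSets H) (hFc : F.Countable)
    (hfip : ∀ F₀ : Set (Set (Omega H)), F₀ ⊆ F → F₀.Finite → (⋂₀ F₀).Nonempty) :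
    (⋂₀ F).Nonempty := by
  obtain ⟨u, hu, hux⟩ := exists_internal_univ H
  choose code hcode hext using fun s : F => hF s.2
  have := hFc.to_subtype
  have hcount : (insert u (Set.range code)).Countable := (Set.countable_range code).insert u
  -- Including the code `u` of $\Omega$ forces the common element into $\Omega$, even when the
  -- family is empty.
  obtain ⟨y, hy⟩ := hsat (insert u (Set.range code))
    (Cardinal.lt_aleph_one_iff.2 (Cardinal.le_aleph0_iff_set_countable.2 hcount)) (by
      intro F₀ hF₀ hfin
      obtain ⟨x, hx⟩ := hfip (extent H '' F₀ ∩ F) Set.inter_subset_right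
        ((hfin.image _).inter_of_left _)
      refine ⟨x.1.1, fun a ha => ?_⟩
      rcases hF₀ ha with rfl | ⟨s, rfl⟩
      · exact (hux _).2 (seg_of_Omega H x)
      · exact hx (extent H (code s)) ⟨⟨_, ha, rfl⟩, by rw [hext]; exact s.2⟩)
  obtain ⟨x, rfl⟩ := hu.2 y (hy u (Set.mem_insert _ _))
  refine ⟨x, fun s hs => ?_⟩
  have h : x ∈ extent H (code ⟨s, hs⟩) := hy _ (Set.mem_insert_of_mem _ ⟨_, rfl⟩)
  rwa [hext] at h

/-- By `exists_code` a fixed internal relation lists all internal subsets of $\Omega$ as its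
sections at hypernatural numbers. -/
theorem mk_internalSets_le (hcard : #U.Hypernat = aleph 1) : #(internalSets H) ≤ aleph 1 := by
  obtain ⟨c, hc⟩ := U.exists_code
  rw [← hcard]
  refine (Cardinal.mk_le_mk_of_subset ?_).trans
    (Cardinal.mk_range_le (f := fun k : U.Hypernat => {x : Omega H | Rel c k.1.1 x.1.1.1}))
  rintro _ ⟨a, ha, rfl⟩
  obtain ⟨k, hk, hx⟩ := hc H.1.1 a.1 H.2 ((isInternalSubset_iff H).1 ha)
  obtain ⟨k, rfl⟩ := exists_carrier (y := U.star (levelSet 0)) hk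
  exact ⟨⟨k, hk⟩, Set.ext fun x => (hx _).symm⟩

/-! ### Binary digits of hypernatural numbers -/

/-- The natural numbers whose first `n` binary digits are given by `p`. -/
def digitSet (p : ℕ → Bool) (n : ℕ) : Set ℕ := {k | ∀ i < n, k.testBit i = p i}

theorem digitSet_mod {p : ℕ → Bool} {n x y : ℕ} (hx : x ∈ digitSet p n) (hy : y ∈ digitSet p n) :
    x % 2 ^ n = y % 2 ^ n := by
  refine Nat.eq_of_testBit_eq fun i => ?_
  rw [Nat.testBit_mod_two_pow, Nat.testBit_mod_two_pow]
  by_cases h : i < n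
  · rw [hx i h, hy i h]
  · simp [h]

/-- For standard `n` the digit set is a finite Boolean combination of the sets $\{k : \text{the }
i\text{-th digit of } k \text{ is } 1\}$, and the star map commutes with differences. Intersections
are written as iterated differences so that `setV_diff` suffices. -/
theorem mem_star_digitSet (p : ℕ → Bool) (n : ℕ) {x : U.Ext} (hx : E x (U.emb (levelSet 0))) :
    E x (U.emb (setV (digitSet p n))) ↔
      ∀ i < n, (E x (U.emb (setV {k | k.testBit i = true})) ↔ p i = true) := by
  induction n with
  | zero =>
    have : digitSet p 0 = Set.univ := by
      ext
      simp [digitSet]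
    simpa [this, setV_univ] using hx
  | succ n ih =>
    rw [Nat.forall_lt_succ_right, ← ih]
    have hcompl : E x (U.emb (setV (Set.univ \ {k | k.testBit n = true}))) ↔
        ¬ E x (U.emb (setV {k | k.testBit n = true})) := by
      rw [setV_diff, setV_univ, and_iff_right hx]
    cases hp : p n
    · have : digitSet p (n + 1) = digitSet p n \ {k | k.testBit n = true} := by
        ext k
        simp only [digitSet, Set.mem_sdiff, Set.mem_ofPred_eq, Nat.forall_lt_succ_right, hp]
        simp
      rw [this, setV_diff]
      simp
    · have : digitSet p (n + 1) = digitSet p n \ (Set.univ \ {k | k.testBit n = true}) := by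
        ext k
        simp only [digitSet, Set.mem_sdiff, Set.mem_ofPred_eq, Nat.forall_lt_succ_right, hp]
        simp
      rw [this, setV_diff, hcompl, not_not]
      simp

open Classical in
/-- The standard binary digits of an element of `{1, …, H}`. -/
noncomputable def digits (x : Omega H) (n : ℕ) : Bool :=
  decide (E x.1.1.1 (U.emb (setV {k | k.testBit n = true})))

theorem exists_internal_cyl (p : ℕ → Bool) (n : ℕ) : ∃ a : U.Carrier, IsInternalSubset H a ∧
    extent H a = cyl (digits H) p n ∧ ∀ x, E x a.1 → E x (U.emb (setV (digitSet p n))) := by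
  obtain ⟨u, hu, hux⟩ := exists_internal_univ H
  obtain ⟨c, hc, hcx⟩ := exists_internal_diff hu (U.setV_powNatV (digitSet p n))
  -- The second difference turns the complement into the intersection of $\Omega$ with the extended
  -- digit set.
  obtain ⟨b, hb, hbx⟩ := exists_internal_diff hu hc.1
  have key (x) : E x b.1 ↔ U.Seg x H.1.1 ∧ E x (U.emb (setV (digitSet p n))) := by
    rw [hbx, hcx, hux]
    tauto
  refine ⟨b, hb, Set.ext fun x => ?_, fun x hx => ((key x).1 hx).2⟩
  change E x.1.1.1 b.1 ↔ ∀ i < n, digits H x i = p i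
  rw [key, and_iff_right (seg_of_Omega H x), mem_star_digitSet p n x.1.2]
  refine forall₂_congr fun i _ => ?_
  classical
  rw [Bool.eq_iff_iff (b := p i)]
  exact iff_congr decide_eq_true_iff.symm Iff.rfl

/-- Numbers with the same first `n` digits are congruent modulo the standard number $2^n$, which
lies below the infinite `H`. Only the upper bound of the Loeb measure by $\mathrm{st}\circ P$ is
needed. -/
theorem loebMeasure_cyl_le {H : U.Hypernat} (hH : U.IsHyperfinite H) (p : ℕ → Bool) (n : ℕ) :
    loebMeasure H (cyl (digits H) p n) ≤ ENNReal.ofReal (2 / 2 ^ n) := by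
  obtain ⟨a, ha, hext, hx⟩ := exists_internal_cyl H p n
  rw [← hext, loebMeasure_apply H (measurableSet_of_internal hH ⟨a, ha, rfl⟩)]
  refine (OuterMeasure.boundedBy_le (m := weight H) _).trans ((weight_extent_le ha).trans
    (ENNReal.ofReal_le_ofReal (st_le (by positivity) fun r hr => ?_)))
  have := U.prob_le_of_modEq (m := 2 ^ n) (by positivity) (R := digitSet p n)
    (fun x hx y hy => digitSet_mod hx hy) H.2 (isHyperfinite_le hH _)
    ((isInternalSubset_iff H).1 ha) hx (prob_internalProb hH ha) hr
  simpa using this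

theorem exists_loebMeasure_cyl_le {H : U.Hypernat} (hH : U.IsHyperfinite H) (p : ℕ → Bool)
    {ε : ENNReal} (hε : ε ≠ 0) : ∃ n, loebMeasure H (cyl (digits H) p n) ≤ ε := by
  have h : Filter.Tendsto (fun n : ℕ => ENNReal.ofReal (2 / 2 ^ n)) Filter.atTop (nhds 0) := by
    rw [← ENNReal.ofReal_zero]
    refine ENNReal.tendsto_ofReal ?_
    have := (tendsto_pow_atTop_nhds_zero_of_lt_one (r := (1 / 2 : ℝ)) (by norm_num)
      (by norm_num)).const_mul 2
    simpa [div_eq_mul_inv] using this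
  obtain ⟨n, hn⟩ := (h.eventually_le_const (pos_iff_ne_zero.2 hε)).exists
  exact ⟨n, (loebMeasure_cyl_le hH p n).trans hn⟩

end NonstandardUniverse

end NSA

open NSA NSA.NonstandardUniverse in
theorem corollary3 (hCH : Cardinal.continuum.{0} = Cardinal.aleph 1)
    (U : NSA.NonstandardUniverse.{u}) (hsat : U.IsSaturated (Cardinal.aleph 1))
    (hcard : Cardinal.mk U.Hypernat = Cardinal.aleph 1)
    (H : U.Hypernat) (hH : U.IsHyperfinite H) :
    NSA.IsCompactMeasureSpace (NSA.NonstandardUniverse.loebMeasure H) := by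
  refine isCompactMeasureSpace_of_cantor hCH _ (internalSets H)
    (fun _ hs => measurableSet_of_internal hH hs) (mk_internalSets_le H hcard)
    (sInter_nonempty_of_isSaturated H hsat) (fun _ hA _ hε => exists_inner hH hA hε)
    (digits H) (fun p n => ?_) fun p _ hε => exists_loebMeasure_cyl_le hH p hε
  obtain ⟨a, ha, hext, -⟩ := exists_internal_cyl H p n
  exact compl_mem_internalSets ⟨a, ha, hext⟩
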